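/- Let $\rho_1,\rho_2,\rho_3$ be qubit density matrices with prior probabilities $q_1\ge q_2\ge q_3\ge 0$, $q_1+q_2+q_3=1$. Let $P_{\rm guess}$ be the maximum of $\sum_{i=1}^3 q_i\,\mathrm{tr}(\rho_iM_i)$ over all POVMs $\{M_i\}_{i=1}^3$ ($M_i\ge 0$, $\sum_i M_i=I_2$); this maximum is attained. Let $\vec v_i\in\mathbb R^3$ be the Bloch vector of $\rho_i$, i.e. $\rho_i=\frac12(I_2+\vec v_i\cdot\vec\sigma)$ with $\vec\sigma$ the Pauli matrices, and let the intrinsic polytope $P$ be the convex hull of $\{q_1\vec v_1,q_2\vec v_2,q_3\vec v_3\}$. Put $$l_1=\|q_2\vec v_2-q_1\vec v_1\|_2,\quad l_2=\|q_3\vec v_3-q_1\vec v_1\|_2,\quad e_1=q_1-q_2,\quad e_2=q_1-q_3,$$ let $\theta_1$ and $\theta_2$ be the inside angles at the vertices $q_1\vec v_1$ and $q_2\vec v_2$ of the triangle with vertices $q_i\vec v_i$, and put $\chi=\chi_2-\chi_1$, where $$\chi_1=\cos^{-1}\frac{l_1(l_2^2-e_2^2)-l_2(l_1^2-e_1^2)\cos\theta_1}{D},\qquad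 \chi_2=\cos^{-1}\frac{e_2(l_1^2-e_1^2)-e_1(l_2^2-e_2^2)}{D},$$ $$D=\sqrt{l_1^2(l_2^2-e_2^2)^2+l_2^2(l_1^2-e_1^2)^2-2l_1l_2(l_1^2-e_1^2)(l_2^2-e_2^2)\cos\theta_1}.$$ The triangle conditions are $$\text{(a)}\ \ l_1>e_1,\ l_2>e_2;\qquad \text{(b)}\ \ \frac{l_1\cos\theta_1+e_1}{l_1+e_1}<\frac{l_1-e_1}{l_2-e_2},\quad \frac{l_2\cos\theta_1+e_2}{l_2+e_2}<\frac{l_2-e_2}{l_1-e_1};$$ $$\text{(c)}\ \ \frac{l_1^2-e_1^2}{2(l_1\cos\chi+e_1)}<\frac{l_1\sin\theta_2}{\sin(\chi+\theta_2)}.$$ Then the number of extreme points of $P$ is one, two or three, and: (i) If $P$ has one extreme point, then $P_{\rm guess}=q_1$. (ii) If $P$ has two extreme points, or if it has three extreme points and the triangle conditions fail, then $$P_{\rm guess}=\max_{i\ne j}\tfrac12\left(q_i+q_j+\|q_i\rho_i-q_j\rho_j\|_1\right),$$ where $\|\cdot\|_1$ is the trace norm. (iii) If $P$ has three extreme points and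 the triangle conditions hold, then $$P_{\rm guess}=q_1+\frac{l_1^2-e_1^2}{2(l_1\cos\chi+e_1)}.$$ Moreover, with $r_1=\frac{l_1^2-e_1^2}{2(l_1\cos\chi+e_1)}$, $r_2=r_1+e_1$, $r_3=r_1+e_2$ and $E=l_1l_2\sin\theta_1+e_2l_1\sin\chi+e_1l_2\sin(\theta_1-\chi)$, an optimal POVM is $M_i=p_i(I_2-\vec w_i\cdot\vec\sigma)$, where $$p_1=\frac{l_1l_2\sin\theta_1-r_1l_1\sin\chi-r_1l_2\sin(\theta_1-\chi)}{E},\quad p_2=\frac{r_2l_2\sin(\theta_1-\chi)}{E},\quad p_3=\frac{r_3l_1\sin\chi}{E},$$ $$\vec w_1=\frac{\sin(\theta_1-\chi)}{l_1\sin\theta_1}(q_2\vec v_2-q_1\vec v_1)+\frac{\sin\chi}{l_2\sin\theta_1}(q_3\vec v_3-q_1\vec v_1),$$ $$\vec w_2=\frac{r_1\vec w_1-(q_2\vec v_2-q_1\vec v_1)}{r_1+e_1},\qquad \vec w_3=\frac{r_1\vec w_1-(q_3\vec v_3-q_1\vec v_1)}{r_1+e_2}.$$ -/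

import Mathlib

open scoped Matrix ComplexOrder

noncomputable section

namespace QSD

/-- A density matrix on `ℂᵈ`: positive semidefinite with unit trace. -/
def IsDensityMatrix {d : ℕ} (ρ : Matrix (Fin d) (Fin d) ℂ) : Prop :=
  ρ.PosSemidef ∧ ρ.trace = 1

/-- A POVM with `N` outcomes on `ℂᵈ`: positive semidefinite matrices summing to the identity. -/
def IsPOVM {N d : ℕ} (M : Fin N → Matrix (Fin d) (Fin d) ℂ) : Prop :=
  (∀ i, (M i).PosSemidef) ∧ ∑ i, M i = 1

/-- The probability `∑ i, q i * tr (ρ i * M i)` of guessing correctly with the measurement `M`.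
(The traces are real when `ρ i` and `M i` are Hermitian.) -/
def correctProb {N d : ℕ} (q : Fin N → ℝ) (ρ M : Fin N → Matrix (Fin d) (Fin d) ℂ) : ℝ :=
  ∑ i, q i * ((ρ i * M i).trace).re

/-- All values of the success probability that can be achieved by a POVM. -/
def correctProbs {N d : ℕ} (q : Fin N → ℝ) (ρ : Fin N → Matrix (Fin d) (Fin d) ℂ) : Set ℝ :=
  {x | ∃ M : Fin N → Matrix (Fin d) (Fin d) ℂ, IsPOVM M ∧ x = correctProb q ρ M}

/-- The guessing probability: the optimal value of `correctProb` over all POVMs. -/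
def guessProb {N d : ℕ} (q : Fin N → ℝ) (ρ : Fin N → Matrix (Fin d) (Fin d) ℂ) : ℝ :=
  sSup (correctProbs q ρ)

/-- The measurement `M` is an optimal POVM. -/
def IsOptimalPOVM {N d : ℕ} (q : Fin N → ℝ) (ρ M : Fin N → Matrix (Fin d) (Fin d) ℂ) : Prop :=
  IsPOVM M ∧ ∀ M' : Fin N → Matrix (Fin d) (Fin d) ℂ, IsPOVM M' →
    correctProb q ρ M' ≤ correctProb q ρ M

/-- The trace norm `‖A‖₁ = tr √(Aᴴ A)`: the sum of the singular values of `A`. -/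
def traceNorm {d : ℕ} (A : Matrix (Fin d) (Fin d) ℂ) : ℝ :=
  ∑ k, √((Matrix.isHermitian_conjTranspose_mul_self A).eigenvalues k)

/-- The set of the pairwise values `(q i + q j + ‖q i ρ i - q j ρ j‖₁) / 2`, `i ≠ j`. -/
def helstromValues {N d : ℕ} (q : Fin N → ℝ) (ρ : Fin N → Matrix (Fin d) (Fin d) ℂ) : Set ℝ :=
  {x | ∃ i j : Fin N, i ≠ j ∧
    x = (1 / 2) * (q i + q j + traceNorm ((q i : ℂ) • ρ i - (q j : ℂ) • ρ j))}

/-! Bloch representation of qubit states -/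

/-- The first Pauli matrix. -/
def pauliX : Matrix (Fin 2) (Fin 2) ℂ := !![0, 1; 1, 0]

/-- The second Pauli matrix. -/
def pauliY : Matrix (Fin 2) (Fin 2) ℂ := !![0, -Complex.I; Complex.I, 0]

/-- The third Pauli matrix. -/
def pauliZ : Matrix (Fin 2) (Fin 2) ℂ := !![1, 0; 0, -1]

/-- `w · σ`, for a vector `w` in Euclidean 3-space. -/
def pauliDot (w : EuclideanSpace ℝ (Fin 3)) : Matrix (Fin 2) (Fin 2) ℂ :=
  (w 0 : ℂ) • pauliX + (w 1 : ℂ) • pauliY + (w 2 : ℂ) • pauliZ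

/-- The Bloch vector of a qubit state. -/
def blochVector (ρ : Matrix (Fin 2) (Fin 2) ℂ) : EuclideanSpace ℝ (Fin 3) :=
  !₂[((ρ * pauliX).trace).re, ((ρ * pauliY).trace).re, ((ρ * pauliZ).trace).re]

/-- `v` is the Bloch vector of `ρ` exactly when `ρ = (1 + v · σ) / 2`. -/
theorem eq_blochVector_iff {ρ : Matrix (Fin 2) (Fin 2) ℂ} (hρ : IsDensityMatrix ρ)
    (v : EuclideanSpace ℝ (Fin 3)) :
    v = blochVector ρ ↔ ρ = (1 / 2 : ℂ) • (1 + pauliDot v) := by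
  obtain ⟨⟨hH, -⟩, ht⟩ := hρ
  have h00 := congrArg Complex.im (hH.apply 0 0)
  have h11 := congrArg Complex.im (hH.apply 1 1)
  have h01r := congrArg Complex.re (hH.apply 0 1)
  have h01i := congrArg Complex.im (hH.apply 0 1)
  have htr := congrArg Complex.re ht
  simp [Matrix.trace, Fin.sum_univ_two] at h00 h11 h01r h01i htr
  constructor
  · rintro rfl
    ext i j
    fin_cases i <;> fin_cases j <;> apply Complex.ext <;>
      simp [pauliDot, pauliX, pauliY, pauliZ, blochVector, Matrix.trace, Matrix.mul_apply,
        Fin.sum_univ_two] <;> linarith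
  · intro h
    ext i
    fin_cases i <;>
      simp [h, pauliDot, pauliX, pauliY, pauliZ, blochVector, Matrix.trace, Matrix.mul_apply,
        Fin.sum_univ_two] <;> ring

/-- The weighted Bloch vectors `q i • v i`. -/
def weightedBloch {N : ℕ} (q : Fin N → ℝ) (ρ : Fin N → Matrix (Fin 2) (Fin 2) ℂ) (i : Fin N) :
    EuclideanSpace ℝ (Fin 3) :=
  q i • blochVector (ρ i)

/-- The intrinsic polytope: the convex hull of the weighted Bloch vectors. -/
def intrinsicPolytope {N : ℕ} (q : Fin N → ℝ) (ρ : Fin N → Matrix (Fin 2) (Fin 2) ℂ) :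
    Set (EuclideanSpace ℝ (Fin 3)) :=
  convexHull ℝ (Set.range (weightedBloch q ρ))

/-- The number of extreme points of the intrinsic polytope. -/
def numExtremePoints {N : ℕ} (q : Fin N → ℝ) (ρ : Fin N → Matrix (Fin 2) (Fin 2) ℂ) : ℕ :=
  (Set.extremePoints ℝ (intrinsicPolytope q ρ)).ncard

/-! The closed formulas, as functions of the two sides `l₁`, `l₂` at the first vertex of a triangle,
the inside angle `θ₁` there, and the differences `e₁`, `e₂` of the priors. -/

/-- The common denominator in `chi₁` and `chi₂`. -/
def chiDenom (l₁ l₂ e₁ e₂ θ₁ : ℝ) : ℝ :=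
  √(l₁ ^ 2 * (l₂ ^ 2 - e₂ ^ 2) ^ 2 + l₂ ^ 2 * (l₁ ^ 2 - e₁ ^ 2) ^ 2
    - 2 * l₁ * l₂ * (l₁ ^ 2 - e₁ ^ 2) * (l₂ ^ 2 - e₂ ^ 2) * Real.cos θ₁)

/-- The angle `χ₁`. -/
def chi₁ (l₁ l₂ e₁ e₂ θ₁ : ℝ) : ℝ :=
  Real.arccos ((l₁ * (l₂ ^ 2 - e₂ ^ 2) - l₂ * (l₁ ^ 2 - e₁ ^ 2) * Real.cos θ₁)
    / chiDenom l₁ l₂ e₁ e₂ θ₁)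

/-- The angle `χ₂`. -/
def chi₂ (l₁ l₂ e₁ e₂ θ₁ : ℝ) : ℝ :=
  Real.arccos ((e₂ * (l₁ ^ 2 - e₁ ^ 2) - e₁ * (l₂ ^ 2 - e₂ ^ 2)) / chiDenom l₁ l₂ e₁ e₂ θ₁)

/-- The angle `χ = χ₂ - χ₁`. -/
def chi (l₁ l₂ e₁ e₂ θ₁ : ℝ) : ℝ := chi₂ l₁ l₂ e₁ e₂ θ₁ - chi₁ l₁ l₂ e₁ e₂ θ₁

/-- The triangle conditions. -/
def TriangleConditions (l₁ l₂ e₁ e₂ θ₁ θ₂ χ : ℝ) : Prop :=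
  (l₁ > e₁ ∧ l₂ > e₂) ∧
  ((l₁ * Real.cos θ₁ + e₁) / (l₁ + e₁) < (l₁ - e₁) / (l₂ - e₂) ∧
    (l₂ * Real.cos θ₁ + e₂) / (l₂ + e₂) < (l₂ - e₂) / (l₁ - e₁)) ∧
  (l₁ ^ 2 - e₁ ^ 2) / (2 * (l₁ * Real.cos χ + e₁)) < l₁ * Real.sin θ₂ / Real.sin (χ + θ₂)

/-- The weights `p` of the optimal POVM in the triangle case. -/
def optWeight (l₁ l₂ e₁ e₂ θ₁ χ r₁ : ℝ) : Fin 3 → ℝ :=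
  ![(l₁ * l₂ * Real.sin θ₁ - r₁ * l₁ * Real.sin χ - r₁ * l₂ * Real.sin (θ₁ - χ))
      / (l₁ * l₂ * Real.sin θ₁ + e₂ * l₁ * Real.sin χ + e₁ * l₂ * Real.sin (θ₁ - χ)),
    (r₁ + e₁) * l₂ * Real.sin (θ₁ - χ)
      / (l₁ * l₂ * Real.sin θ₁ + e₂ * l₁ * Real.sin χ + e₁ * l₂ * Real.sin (θ₁ - χ)),
    (r₁ + e₂) * l₁ * Real.sin χ
      / (l₁ * l₂ * Real.sin θ₁ + e₂ * l₁ * Real.sin χ + e₁ * l₂ * Real.sin (θ₁ - χ))]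

/-- The vector `w₁` of the optimal POVM in the triangle case; `u` is the family of the weighted
Bloch vectors. -/
def optDir₁ (u : Fin 3 → EuclideanSpace ℝ (Fin 3)) (l₁ l₂ θ₁ χ : ℝ) : EuclideanSpace ℝ (Fin 3) :=
  (Real.sin (θ₁ - χ) / (l₁ * Real.sin θ₁)) • (u 1 - u 0)
    + (Real.sin χ / (l₂ * Real.sin θ₁)) • (u 2 - u 0)

/-- The vectors `w₁`, `w₂`, `w₃` of the optimal POVM in the triangle case. -/
def optDir (u : Fin 3 → EuclideanSpace ℝ (Fin 3)) (l₁ l₂ e₁ e₂ θ₁ χ r₁ : ℝ) :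
    Fin 3 → EuclideanSpace ℝ (Fin 3) :=
  ![optDir₁ u l₁ l₂ θ₁ χ,
    (r₁ + e₁)⁻¹ • (r₁ • optDir₁ u l₁ l₂ θ₁ χ - (u 1 - u 0)),
    (r₁ + e₂)⁻¹ • (r₁ • optDir₁ u l₁ l₂ θ₁ χ - (u 2 - u 0))]

end QSD

end

open scoped Matrix ComplexOrder

noncomputable section

namespace QSD

open scoped InnerProductSpace

/-! In Bloch coordinates the problem is that of the smallest ball enclosing the balls of radius `q
i` about `u i = q i • v i`, and `guessProb` is its radius. An enclosing ball of radius `R` bounds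
every measurement by `R` (`correctProb_le`). Conversely, the radius is attained when two balls
determine the ball (`pairRadius_mem_correctProbs`) and when it touches all three with its center in
their triangle (`isOptimalPOVM_of_touching`). The radius for two balls is the Helstrom value.

Coincident centers give `q 0`. Centers on a line reduce to intervals, whose hull is set by at most
two of them. For a genuine triangle, seek a center `c = u 0 + r • w`, with `w` a unit vector at
angle `χ` from the first side, and distances `r`, `r + e₁`, `r + e₂` to the vertices. The law of
cosines turns this into two formulas for `r`; their agreement is linear in `cos χ` and `sin χ` and
is solved by `χ = χ₂ - χ₁` (`chi_mem_and_balance`, `touching_center`).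

Given (a), condition (b) forces `0 < χ < θ₁`, and (c) keeps `c` on the near side of the edge
opposite `u 0`. Then `c` lies in the triangle and its barycentric coordinates, rescaled by the
distances, are the weights of the POVM. Each failure leaves a pair whose enclosing ball contains the
third: a nested ball if (a) fails, a pair containing `0` if (b) fails, the pair `1, 2` if only (c)
fails. -/

/-! ### Bloch calculus, POVMs and weak duality -/

theorem blochVector_sum {N : ℕ} (M : Fin N → Matrix (Fin 2) (Fin 2) ℂ) :
    blochVector (∑ i, M i) = ∑ i, blochVector (M i) := by
  ext k
  fin_cases k <;> simp [blochVector, Finset.sum_mul, Matrix.trace_sum]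

theorem blochVector_one : blochVector 1 = 0 := by
  ext k
  fin_cases k <;> simp [blochVector, pauliX, pauliY, pauliZ, Matrix.trace, Fin.sum_univ_two]

theorem blochVector_smul_sub_smul (a b : ℝ) (A B : Matrix (Fin 2) (Fin 2) ℂ) :
    blochVector ((a : ℂ) • A - (b : ℂ) • B) = a • blochVector A - b • blochVector B := by
  ext k
  fin_cases k <;> simp [blochVector, sub_mul, Matrix.trace_sub]

theorem blochVector_smul_one_add_pauliDot (p : ℝ) (w : EuclideanSpace ℝ (Fin 3)) :
    blochVector ((p : ℂ) • (1 + pauliDot w)) = (2 * p) • w := by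
  ext k
  fin_cases k <;>
    simp [blochVector, pauliDot, pauliX, pauliY, pauliZ, Matrix.trace, Fin.sum_univ_two,
      Matrix.mul_apply] <;> ring

theorem trace_smul_one_add_pauliDot (p : ℝ) (w : EuclideanSpace ℝ (Fin 3)) :
    ((p : ℂ) • (1 + pauliDot w)).trace.re = 2 * p := by
  simp [pauliDot, pauliX, pauliY, pauliZ, Matrix.trace, Fin.sum_univ_two]
  ring

theorem one_sub_pauliDot (w : EuclideanSpace ℝ (Fin 3)) :
    1 - pauliDot w = 1 + pauliDot (-w) := by
  simp [pauliDot]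
  abel

theorem isHermitian_entries {M : Matrix (Fin 2) (Fin 2) ℂ} (hM : M.IsHermitian) :
    (M 0 0).im = 0 ∧ (M 1 1).im = 0 ∧ (M 0 1).re = (M 1 0).re ∧ (M 0 1).im = -(M 1 0).im := by
  have h00 := congrArg Complex.im (hM.apply 0 0)
  have h11 := congrArg Complex.im (hM.apply 1 1)
  have h01r := congrArg Complex.re (hM.apply 0 1)
  have h01i := congrArg Complex.im (hM.apply 0 1)
  simp at h00 h11 h01r h01i
  refine ⟨?_, ?_, ?_, ?_⟩ <;> linarith

theorem norm_sq_blochVector {M : Matrix (Fin 2) (Fin 2) ℂ} (hM : M.IsHermitian) :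
    ‖blochVector M‖ ^ 2 = M.trace.re ^ 2 - 4 * M.det.re := by
  obtain ⟨h0, h1, h2, h3⟩ := isHermitian_entries hM
  rw [EuclideanSpace.norm_sq_eq]
  simp [Fin.sum_univ_three, blochVector, pauliX, pauliY, pauliZ, Matrix.trace,
    Fin.sum_univ_two, Matrix.mul_apply, Matrix.det_fin_two, h0, h1, h2, h3]
  ring

theorem det_im_of_isHermitian {M : Matrix (Fin 2) (Fin 2) ℂ} (hM : M.IsHermitian) :
    M.det.im = 0 := by
  obtain ⟨h0, h1, h2, h3⟩ := isHermitian_entries hM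
  simp [Matrix.det_fin_two, h0, h1, h2, h3]
  ring

theorem norm_blochVector_le {M : Matrix (Fin 2) (Fin 2) ℂ} (hM : M.PosSemidef) :
    ‖blochVector M‖ ≤ M.trace.re := by
  have hd := (Complex.le_def.1 hM.det_nonneg).1
  have ht := (Complex.le_def.1 hM.trace_nonneg).1
  have h := norm_sq_blochVector hM.1
  simp at hd ht
  exact abs_le_of_sq_le_sq' (by linarith) ht |>.2

theorem trace_mul_re {A B : Matrix (Fin 2) (Fin 2) ℂ} (hA : A.IsHermitian) (hB : B.IsHermitian) :
    (A * B).trace.re =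
      (A.trace.re * B.trace.re + ⟪blochVector A, blochVector B⟫_ℝ) / 2 := by
  obtain ⟨h0, h1, h2, h3⟩ := isHermitian_entries hA
  obtain ⟨k0, k1, k2, k3⟩ := isHermitian_entries hB
  simp [PiLp.inner_apply, Fin.sum_univ_three, blochVector, pauliX, pauliY, pauliZ, Matrix.trace,
    Fin.sum_univ_two, Matrix.mul_apply, h0, h1, h2, h3, k0, k1, k2, k3]
  ring

theorem posSemidef_smul_one_add_pauliDot {p : ℝ} (hp : 0 ≤ p) {w : EuclideanSpace ℝ (Fin 3)}
    (hw : ‖w‖ ≤ 1) : ((p : ℂ) • (1 + pauliDot w)).PosSemidef := by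
  have hn : ‖w‖ ^ 2 ≤ 1 := by nlinarith [norm_nonneg w]
  have hw2 : ‖w‖ ^ 2 = w 0 ^ 2 + w 1 ^ 2 + w 2 ^ 2 := by
    rw [EuclideanSpace.norm_sq_eq]
    simp [Fin.sum_univ_three]
  -- Since `(w · σ)² = ‖w‖²`, the square of `1 + w · σ` is `2 (1 + w · σ) - (1 - ‖w‖²)`.
  have hdecomp : (p : ℂ) • (1 + pauliDot w) =
      ((p / 2 : ℝ) : ℂ) • ((1 + pauliDot w)ᴴ * (1 + pauliDot w))
        + ((p / 2 * (1 - ‖w‖ ^ 2) : ℝ) : ℂ) • 1 := by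
    rw [hw2]
    ext i j
    fin_cases i <;> fin_cases j <;> apply Complex.ext <;>
      simp [pauliDot, pauliX, pauliY, pauliZ, Matrix.mul_apply, Fin.sum_univ_two]
    all_goals try ring_nf
    all_goals simp [← Complex.ofReal_pow]
    all_goals ring
  rw [hdecomp]
  refine Matrix.PosSemidef.add ?_ ?_
  · exact (Matrix.posSemidef_conjTranspose_mul_self _).smul
      (Complex.zero_le_real.2 (by linarith))
  · exact Matrix.PosSemidef.one.smul
      (Complex.zero_le_real.2 (mul_nonneg (by linarith) (by linarith)))

theorem isPOVM_smul_one_add_pauliDot {N : ℕ} {p : Fin N → ℝ}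
    {w : Fin N → EuclideanSpace ℝ (Fin 3)} (hp : ∀ i, 0 ≤ p i) (hw : ∀ i, ‖w i‖ ≤ 1)
    (hsum : ∑ i, p i = 1) (hbal : ∑ i, p i • w i = 0) :
    IsPOVM fun i => (p i : ℂ) • (1 + pauliDot (w i)) := by
  refine ⟨fun i => posSemidef_smul_one_add_pauliDot (hp i) (hw i), ?_⟩
  have hk (k : Fin 3) : ∑ i, (p i : ℂ) * (w i k : ℂ) = 0 := by
    have := congrArg (fun v : EuclideanSpace ℝ (Fin 3) => v k) hbal
    simp at this
    exact_mod_cast this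
  have hs : ∑ i, (p i : ℂ) = 1 := by exact_mod_cast hsum
  simp only [pauliDot, smul_add, smul_smul, Finset.sum_add_distrib, ← Finset.sum_smul, hk, hs]
  simp

theorem correctProb_eq {N : ℕ} {q : Fin N → ℝ} {ρ M : Fin N → Matrix (Fin 2) (Fin 2) ℂ}
    (hρ : ∀ i, IsDensityMatrix (ρ i)) (hM : ∀ i, (M i).PosSemidef) :
    correctProb q ρ M = ∑ i, (q i * (M i).trace.re
      + ⟪weightedBloch q ρ i, blochVector (M i)⟫_ℝ) / 2 := by
  refine Finset.sum_congr rfl fun i _ => ?_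
  rw [trace_mul_re (hρ i).1.1 (hM i).1, (hρ i).2, weightedBloch, real_inner_smul_left]
  simp
  ring

theorem correctProb_smul_one_add_pauliDot {N : ℕ} {q p : Fin N → ℝ}
    {ρ : Fin N → Matrix (Fin 2) (Fin 2) ℂ} {w : Fin N → EuclideanSpace ℝ (Fin 3)}
    (hρ : ∀ i, IsDensityMatrix (ρ i)) (hp : ∀ i, 0 ≤ p i) (hw : ∀ i, ‖w i‖ ≤ 1) :
    correctProb q ρ (fun i => (p i : ℂ) • (1 + pauliDot (w i))) =
      ∑ i, p i * (q i + ⟪weightedBloch q ρ i, w i⟫_ℝ) := by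
  rw [correctProb_eq hρ fun i => posSemidef_smul_one_add_pauliDot (hp i) (hw i)]
  refine Finset.sum_congr rfl fun i _ => ?_
  rw [blochVector_smul_one_add_pauliDot, trace_smul_one_add_pauliDot, real_inner_smul_right]
  ring

/-- Weak duality: a ball of radius `R` containing the balls of radius `q i` around the weighted
Bloch vectors bounds the success probability of every measurement. -/
theorem correctProb_le {N : ℕ} {q : Fin N → ℝ} {ρ M : Fin N → Matrix (Fin 2) (Fin 2) ℂ}
    (hρ : ∀ i, IsDensityMatrix (ρ i)) (hM : IsPOVM M) {R : ℝ} {c : EuclideanSpace ℝ (Fin 3)}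
    (hc : ∀ i, ‖c - weightedBloch q ρ i‖ ≤ R - q i) : correctProb q ρ M ≤ R := by
  have htr : ∑ i, (M i).trace.re = 2 := by
    have := congrArg (fun A : Matrix (Fin 2) (Fin 2) ℂ => A.trace.re) hM.2
    simpa [Matrix.trace_sum] using this
  have hb : ∑ i, ⟪c, blochVector (M i)⟫_ℝ = 0 := by
    rw [← inner_sum, ← blochVector_sum, hM.2, blochVector_one, inner_zero_right]
  rw [correctProb_eq hρ hM.1]
  -- Cauchy–Schwarz, with `‖blochVector (M i)‖ ≤ tr (M i)`; the term in `c` disappears on summing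
  -- over the POVM.
  have key : ∀ i, (q i * (M i).trace.re + ⟪weightedBloch q ρ i, blochVector (M i)⟫_ℝ) / 2 ≤
      (R * (M i).trace.re + ⟪c, blochVector (M i)⟫_ℝ) / 2 := by
    intro i
    have h1 := abs_le.1 (abs_real_inner_le_norm (c - weightedBloch q ρ i) (blochVector (M i)))
    rw [inner_sub_left] at h1
    have h2 := mul_le_mul (hc i) (norm_blochVector_le (hM.1 i)) (norm_nonneg _)
      ((norm_nonneg _).trans (hc i))
    linarith [h1.1]
  calc _ ≤ _ := Finset.sum_le_sum fun i _ => key i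
    _ = R := by
      rw [← Finset.sum_div, Finset.sum_add_distrib, ← Finset.mul_sum, htr, hb]
      ring

/-! ### Trace norm and the values attained by one or two outcomes -/

/-- The eigenvalues of `A` are `(t ± ‖b‖) / 2` with `t` the trace and `b` the Bloch vector. The
proof avoids them: the squared trace norm is `tr A² + 2 |det A|`, and the sign of `det A` decides
which of `t²`, `‖b‖²` this is. -/
theorem traceNorm_of_isHermitian {A : Matrix (Fin 2) (Fin 2) ℂ} (hA : A.IsHermitian) :
    traceNorm A = max |A.trace.re| ‖blochVector A‖ := by
  have hB := Matrix.isHermitian_conjTranspose_mul_self A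
  have hpos : ∀ k, 0 ≤ hB.eigenvalues k :=
    fun k => (Matrix.posSemidef_conjTranspose_mul_self A).eigenvalues_nonneg k
  have htr : hB.eigenvalues 0 + hB.eigenvalues 1 = (Aᴴ * A).trace.re := by
    rw [hB.trace_eq_sum_eigenvalues]
    simp [Fin.sum_univ_two]
  have hdet : hB.eigenvalues 0 * hB.eigenvalues 1 = A.det.re ^ 2 := by
    have h := congrArg Complex.re hB.det_eq_prod_eigenvalues
    rw [Matrix.det_mul, Matrix.det_conjTranspose,
      show star A.det = A.det from Complex.conj_eq_iff_im.2 (det_im_of_isHermitian hA),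
      Complex.mul_re, det_im_of_isHermitian hA] at h
    simp [Fin.prod_univ_two] at h
    linarith
  have htr' : (Aᴴ * A).trace.re = (A.trace.re ^ 2 + ‖blochVector A‖ ^ 2) / 2 := by
    rw [hA.eq, trace_mul_re hA hA, real_inner_self_eq_norm_sq, sq A.trace.re]
  rw [htr'] at htr
  have hn := norm_sq_blochVector hA
  set x := hB.eigenvalues 0
  set y := hB.eigenvalues 1
  have hsq : (√x + √y) ^ 2 = x + y + 2 * |A.det.re| := by
    rw [← Real.sqrt_sq_eq_abs, ← hdet, Real.sqrt_mul (hpos 0), add_sq, Real.sq_sqrt (hpos 0),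
      Real.sq_sqrt (hpos 1)]
    ring
  have hT : traceNorm A = √x + √y := by simp [traceNorm, Fin.sum_univ_two, x, y]
  have h0 : 0 ≤ √x + √y := by positivity
  rw [hT]
  rcases le_total 0 A.det.re with hd | hd
  · rw [abs_of_nonneg hd] at hsq
    have : ‖blochVector A‖ ≤ |A.trace.re| :=
      abs_le_of_sq_le_sq' (by rw [sq_abs]; linarith) (abs_nonneg _) |>.2
    rw [max_eq_left this, ← abs_of_nonneg h0]
    exact (sq_eq_sq_iff_abs_eq_abs _ _).1 (by linarith)
  · rw [abs_of_nonpos hd] at hsq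
    have : |A.trace.re| ≤ ‖blochVector A‖ :=
      abs_le_of_sq_le_sq' (by rw [sq_abs]; linarith) (norm_nonneg _) |>.2
    rw [max_eq_right this, ← abs_of_nonneg h0, ← abs_of_nonneg (norm_nonneg (blochVector A))]
    exact (sq_eq_sq_iff_abs_eq_abs _ _).1 (by linarith)

/-- The radius of the smallest ball containing the balls of radii `a`, `b` around `x`, `y`. -/
def pairRadius (a b : ℝ) (x y : EuclideanSpace ℝ (Fin 3)) : ℝ :=
  max (max a b) ((a + b + ‖x - y‖) / 2)

/-- The trace `q i - q j` accounts for nested balls, as `(q i + q j + |q i - q j|) / 2` is the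
larger prior. -/
theorem helstromValue_eq {N : ℕ} {q : Fin N → ℝ} {ρ : Fin N → Matrix (Fin 2) (Fin 2) ℂ}
    (hρ : ∀ i, IsDensityMatrix (ρ i)) (i j : Fin N) :
    (1 / 2) * (q i + q j + traceNorm ((q i : ℂ) • ρ i - (q j : ℂ) • ρ j)) =
      pairRadius (q i) (q j) (weightedBloch q ρ i) (weightedBloch q ρ j) := by
  have hH : ((q i : ℂ) • ρ i - (q j : ℂ) • ρ j).IsHermitian := by
    refine Matrix.IsHermitian.sub ?_ ?_
    · rw [Matrix.IsHermitian, Matrix.conjTranspose_smul, (hρ i).1.1.eq]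
      simp
    · rw [Matrix.IsHermitian, Matrix.conjTranspose_smul, (hρ j).1.1.eq]
      simp
  have ht : ((q i : ℂ) • ρ i - (q j : ℂ) • ρ j).trace.re = q i - q j := by
    simp [Matrix.trace_sub, (hρ i).2, (hρ j).2]
  rw [traceNorm_of_isHermitian hH, ht, blochVector_smul_sub_smul, pairRadius]
  simp only [weightedBloch]
  grind [abs_of_nonneg, abs_of_neg]

theorem exists_correctProb_eq_prior {N : ℕ} {q : Fin N → ℝ}
    {ρ : Fin N → Matrix (Fin 2) (Fin 2) ℂ} (hρ : ∀ i, IsDensityMatrix (ρ i)) (i : Fin N) :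
    q i ∈ correctProbs q ρ := by
  have hp : ∀ k, (0 : ℝ) ≤ (Pi.single i 1 : Fin N → ℝ) k := fun k => by
    by_cases h : k = i <;> simp [h]
  refine ⟨_, isPOVM_smul_one_add_pauliDot (w := fun _ => 0) hp (by simp) (by simp) (by simp), ?_⟩
  rw [correctProb_smul_one_add_pauliDot hρ hp (by simp)]
  simp [Pi.single_apply]

theorem exists_correctProb_eq_pair {N : ℕ} {q : Fin N → ℝ}
    {ρ : Fin N → Matrix (Fin 2) (Fin 2) ℂ} (hρ : ∀ i, IsDensityMatrix (ρ i)) {i j : Fin N}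
    (hij : i ≠ j) :
    (q i + q j + ‖weightedBloch q ρ i - weightedBloch q ρ j‖) / 2 ∈ correctProbs q ρ := by
  -- For coincident centers `n` is `0`, because `0⁻¹ = 0`; hence only `‖n‖ ≤ 1` is claimed.
  set n := ‖weightedBloch q ρ i - weightedBloch q ρ j‖⁻¹ •
    (weightedBloch q ρ i - weightedBloch q ρ j) with hn
  have hn1 : ‖n‖ ≤ 1 := by
    rw [hn, norm_smul, norm_inv, norm_norm]
    exact inv_mul_le_one
  have hnin : ⟪weightedBloch q ρ i - weightedBloch q ρ j, n⟫_ℝ =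
      ‖weightedBloch q ρ i - weightedBloch q ρ j‖ := by
    rw [hn, real_inner_smul_right, real_inner_self_eq_norm_sq]
    by_cases h : ‖weightedBloch q ρ i - weightedBloch q ρ j‖ = 0
    · simp [h]
    · field_simp
  set p : Fin N → ℝ := fun k => if k = i then 1 / 2 else if k = j then 1 / 2 else 0 with hpdef
  set w : Fin N → EuclideanSpace ℝ (Fin 3) := fun k => if k = i then n else -n with hwdef
  have hp : ∀ k, 0 ≤ p k := fun k => by
    simp only [hpdef]
    split_ifs <;> norm_num
  have hw : ∀ k, ‖w k‖ ≤ 1 := fun k => by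
    simp only [hwdef]
    split_ifs <;> simpa using hn1
  have hsum {V : Type} [AddCommGroup V] (f : Fin N → V) (hf : ∀ k, k ≠ i → k ≠ j → f k = 0) :
      ∑ k, f k = f i + f j := by
    rw [← Finset.sum_pair hij]
    symm
    refine Finset.sum_subset (Finset.subset_univ _) fun k _ hk => ?_
    simp at hk
    exact hf k hk.1 hk.2
  have hp0 : ∀ k, k ≠ i → k ≠ j → p k = 0 := fun k h1 h2 => by simp [hpdef, h1, h2]
  have hpi : p i = 1 / 2 := by simp [hpdef]
  have hpj : p j = 1 / 2 := by simp [hpdef]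
  have hwi : w i = n := by simp [hwdef]
  have hwj : w j = -n := by simp [hwdef, hij.symm]
  refine ⟨_, isPOVM_smul_one_add_pauliDot (w := w) hp hw ?_ ?_, ?_⟩
  · rw [hsum p hp0, hpi, hpj]
    norm_num
  · rw [hsum _ fun k h1 h2 => by rw [hp0 k h1 h2, zero_smul], hpi, hpj, hwi, hwj]
    simp
  · rw [correctProb_smul_one_add_pauliDot hρ hp hw,
      hsum _ fun k h1 h2 => by rw [hp0 k h1 h2, zero_mul], hpi, hpj, hwi, hwj, ← hnin,
      inner_sub_left, inner_neg_right]
    ring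

theorem pairRadius_mem_correctProbs {N : ℕ} {q : Fin N → ℝ}
    {ρ : Fin N → Matrix (Fin 2) (Fin 2) ℂ} (hρ : ∀ i, IsDensityMatrix (ρ i)) {i j : Fin N}
    (hij : i ≠ j) :
    pairRadius (q i) (q j) (weightedBloch q ρ i) (weightedBloch q ρ j) ∈ correctProbs q ρ := by
  rw [pairRadius]
  rcases max_choice (max (q i) (q j))
      ((q i + q j + ‖weightedBloch q ρ i - weightedBloch q ρ j‖) / 2) with h | h <;> rw [h]
  · rcases max_choice (q i) (q j) with h' | h' <;> rw [h'] <;>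
      exact exists_correctProb_eq_prior hρ _
  · exact exists_correctProb_eq_pair hρ hij

theorem isGreatest_correctProbs {N : ℕ} {q : Fin N → ℝ} {ρ : Fin N → Matrix (Fin 2) (Fin 2) ℂ}
    (hρ : ∀ i, IsDensityMatrix (ρ i)) {R : ℝ} (hR : R ∈ correctProbs q ρ)
    {c : EuclideanSpace ℝ (Fin 3)} (hc : ∀ i, ‖c - weightedBloch q ρ i‖ ≤ R - q i) :
    IsGreatest (correctProbs q ρ) R := by
  refine ⟨hR, ?_⟩
  rintro x ⟨M, hM, rfl⟩
  exact correctProb_le hρ hM hc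

theorem guessProb_eq {N d : ℕ} {q : Fin N → ℝ} {ρ : Fin N → Matrix (Fin d) (Fin d) ℂ} {R : ℝ}
    (h : IsGreatest (correctProbs q ρ) R) : guessProb q ρ = R :=
  h.csSup_eq

/-- If the smallest ball around a pair of the balls contains all of them, then the guessing
probability is the largest of the pairwise values. -/
theorem isGreatest_of_pair_cover {N : ℕ} {q : Fin N → ℝ}
    {ρ : Fin N → Matrix (Fin 2) (Fin 2) ℂ} (hρ : ∀ i, IsDensityMatrix (ρ i))
    (h : ∃ i j : Fin N, i ≠ j ∧ ∃ c, ∀ k, ‖c - weightedBloch q ρ k‖ ≤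
      pairRadius (q i) (q j) (weightedBloch q ρ i) (weightedBloch q ρ j) - q k) :
    IsGreatest (correctProbs q ρ) (guessProb q ρ) ∧
      IsGreatest (helstromValues q ρ) (guessProb q ρ) := by
  obtain ⟨i, j, hij, c, hc⟩ := h
  have hg := isGreatest_correctProbs hρ (pairRadius_mem_correctProbs hρ hij) hc
  rw [guessProb_eq hg]
  refine ⟨hg, ⟨i, j, hij, (helstromValue_eq hρ i j).symm⟩, ?_⟩
  rintro x ⟨k, l, hkl, rfl⟩
  rw [helstromValue_eq hρ]
  exact hg.2 (pairRadius_mem_correctProbs hρ hkl)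

/-! ### The angle `χ` and the radius `r` -/

section Angle

variable {l₁ l₂ e₁ e₂ θ : ℝ}

/-- With `X = l₁ B - l₂ A cos θ` and `Y = l₂ A sin θ`, the equation reads `X cos χ - Y sin χ = e₂ A
- e₁ B`. In polar form `(X, Y) = D (cos a, sin a)` this is `cos (χ + a) = cos b`, where `a`, `b` are
`χ₁`, `χ₂`. The two inequalities of (b) say `cos (θ + a) < cos b < cos a`. -/
theorem chi_mem_and_balance (hl₁ : 0 < l₁) (hl₂ : 0 < l₂) (he₁ : 0 ≤ e₁) (he₂ : 0 ≤ e₂)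
    (hθ : 0 < θ) (hθπ : θ < Real.pi) (h₁ : e₁ < l₁) (h₂ : e₂ < l₂)
    (hb₁ : (l₁ * Real.cos θ + e₁) / (l₁ + e₁) < (l₁ - e₁) / (l₂ - e₂))
    (hb₂ : (l₂ * Real.cos θ + e₂) / (l₂ + e₂) < (l₂ - e₂) / (l₁ - e₁)) :
    0 < chi l₁ l₂ e₁ e₂ θ ∧ chi l₁ l₂ e₁ e₂ θ < θ ∧
      (l₁ ^ 2 - e₁ ^ 2) * (l₂ * Real.cos (θ - chi l₁ l₂ e₁ e₂ θ) + e₂) =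
        (l₂ ^ 2 - e₂ ^ 2) * (l₁ * Real.cos (chi l₁ l₂ e₁ e₂ θ) + e₁) := by
  rw [div_lt_div_iff₀ (by linarith) (by linarith)] at hb₁ hb₂
  obtain ⟨A, hA⟩ : ∃ A, A = l₁ ^ 2 - e₁ ^ 2 := ⟨_, rfl⟩
  obtain ⟨B, hB⟩ : ∃ B, B = l₂ ^ 2 - e₂ ^ 2 := ⟨_, rfl⟩
  have hApos : 0 < A := by rw [hA]; nlinarith
  have hBpos : 0 < B := by rw [hB]; nlinarith
  have hs : 0 < Real.sin θ := Real.sin_pos_of_pos_of_lt_pi hθ hθπ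
  have hcs := Real.sin_sq_add_cos_sq θ
  obtain ⟨X, hX⟩ : ∃ X, X = l₁ * B - l₂ * A * Real.cos θ := ⟨_, rfl⟩
  obtain ⟨Y, hY⟩ : ∃ Y, Y = l₂ * A * Real.sin θ := ⟨_, rfl⟩
  have hYpos : 0 < Y := by rw [hY]; positivity
  have hDdef : chiDenom l₁ l₂ e₁ e₂ θ = √(X ^ 2 + Y ^ 2) := by
    rw [chiDenom, ← hA, ← hB, hX, hY]
    congr 1
    linear_combination (-(l₂ ^ 2 * A ^ 2)) * hcs
  obtain ⟨D, hD⟩ : ∃ D, D = √(X ^ 2 + Y ^ 2) := ⟨_, rfl⟩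
  have hDpos : 0 < D := by rw [hD]; positivity
  have hDsq : D ^ 2 = X ^ 2 + Y ^ 2 := by rw [hD, Real.sq_sqrt (by positivity)]
  have hXD : |X| ≤ D := abs_le_of_sq_le_sq (by nlinarith) hDpos.le
  rw [abs_le] at hXD
  obtain ⟨a, ha⟩ : ∃ a, a = Real.arccos (X / D) := ⟨_, rfl⟩
  obtain ⟨b, hb⟩ : ∃ b, b = Real.arccos ((e₂ * A - e₁ * B) / D) := ⟨_, rfl⟩
  have hchi : chi l₁ l₂ e₁ e₂ θ = b - a := by
    rw [chi, chi₁, chi₂, hDdef, ← hA, ← hB, ← hD, hb, ha, hX]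
  have hcosa : Real.cos a * D = X := by
    rw [ha, Real.cos_arccos (by rw [le_div_iff₀ hDpos]; linarith)
      (by rw [div_le_iff₀ hDpos]; linarith)]
    field_simp
  have ha0 : 0 ≤ a := ha ▸ Real.arccos_nonneg _
  have haπ : a ≤ Real.pi := ha ▸ Real.arccos_le_pi _
  have hsina : Real.sin a * D = Y := by
    have h0 : 0 ≤ Real.sin a := Real.sin_nonneg_of_nonneg_of_le_pi ha0 haπ
    refine (sq_eq_sq₀ (by positivity) hYpos.le).1 ?_
    have := Real.sin_sq_add_cos_sq a
    linear_combination D ^ 2 * this + hDsq - (Real.cos a * D + X) * hcosa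
  have hsum : 0 < Real.sin (θ + a) := by
    have : 0 < Real.sin (θ + a) * D := by
      rw [Real.sin_add]
      have h : (Real.sin θ * Real.cos a + Real.cos θ * Real.sin a) * D = l₁ * B * Real.sin θ := by
        linear_combination Real.sin θ * hcosa + Real.cos θ * hsina + Real.sin θ * hX
          + Real.cos θ * hY
      rw [h]
      positivity
    exact pos_of_mul_pos_left this hDpos.le
  -- Needed so that `arccos` inverts `cos` at `θ + a`.
  have hsumπ : θ + a < Real.pi := by
    by_contra! h
    have := Real.sin_nonneg_of_nonneg_of_le_pi (x := θ + a - Real.pi) (by linarith) (by linarith)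
    rw [Real.sin_sub_pi] at this
    linarith
  have hcossum : Real.cos (θ + a) * D = l₁ * B * Real.cos θ - l₂ * A := by
    rw [Real.cos_add]
    linear_combination Real.cos θ * hcosa - Real.sin θ * hsina + Real.cos θ * hX
      - Real.sin θ * hY - l₂ * A * hcs
  have hz₁ : (e₂ * A - e₁ * B) / D < Real.cos a := by
    rw [div_lt_iff₀ hDpos, hcosa, hX]
    have h := mul_lt_mul_of_pos_right hb₂ (show 0 < l₁ + e₁ by linarith)
    rw [hA, hB]
    linarith
  have hz₂ : Real.cos (θ + a) < (e₂ * A - e₁ * B) / D := by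
    rw [lt_div_iff₀ hDpos, hcossum]
    have h := mul_lt_mul_of_pos_right hb₁ (show 0 < l₂ + e₂ by linarith)
    rw [hA, hB]
    linarith
  -- The argument of `χ₂` lies in `(-1, 1)`, so `arccos` is not truncated there.
  have hz₁' := hz₁.trans_le (Real.cos_le_one a)
  have hz₂' := (Real.neg_one_le_cos (θ + a)).trans_lt hz₂
  have hab : a < b := by
    rw [hb, ← Real.arccos_cos ha0 haπ]
    exact Real.arccos_lt_arccos hz₂'.le hz₁ (Real.cos_le_one a)
  have hba : b < θ + a := by
    rw [hb, ← Real.arccos_cos (show 0 ≤ θ + a by linarith) hsumπ.le]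
    exact Real.arccos_lt_arccos (Real.neg_one_le_cos _) hz₂ hz₁'.le
  have hcosb : Real.cos b * D = e₂ * A - e₁ * B := by
    rw [hb, Real.cos_arccos hz₂'.le hz₁'.le]
    field_simp
  rw [hchi, ← hA, ← hB]
  refine ⟨by linarith, by linarith, ?_⟩
  have hexp : Real.cos b * D = Real.cos (b - a) * X - Real.sin (b - a) * Y := by
    rw [← hcosa, ← hsina]
    conv_lhs => rw [show b = (b - a) + a by ring, Real.cos_add]
    ring
  rw [Real.cos_sub θ (b - a)]
  linear_combination hexp - hcosb + Real.cos (b - a) * hX - Real.sin (b - a) * hY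

/-- `x` and `y` have the same sign. Were they nonpositive, both cosines would be too, so `χ` and `θ
- χ` would be at least `π / 2`, against `θ < π`. -/
theorem radius_pos_and_eq {A B x y χ : ℝ} (hl₁ : 0 < l₁) (hl₂ : 0 < l₂) (he₁ : 0 ≤ e₁)
    (he₂ : 0 ≤ e₂) (hθπ : θ < Real.pi) (hA : 0 < A) (hB : 0 < B) (h0 : 0 < χ) (h1 : χ < θ)
    (hx : x = l₁ * Real.cos χ + e₁) (hy : y = l₂ * Real.cos (θ - χ) + e₂)
    (h : A * y = B * x) : 0 < x ∧ 0 < y ∧ A / (2 * x) = B / (2 * y) := by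
  have hx0 : 0 < x := by
    by_contra! hx0
    have hy0 : y ≤ 0 := by
      by_contra! hy0
      nlinarith [mul_pos hA hy0]
    have hc1 : Real.cos χ ≤ 0 := by
      by_contra! hc
      nlinarith [mul_pos hl₁ hc]
    have hc2 : Real.cos (θ - χ) ≤ 0 := by
      by_contra! hc
      nlinarith [mul_pos hl₂ hc]
    have hχ : Real.pi / 2 ≤ χ := by
      by_contra! hlt
      exact hc1.not_gt (Real.cos_pos_of_mem_Ioo ⟨by linarith [Real.pi_pos], hlt⟩)
    have hθχ : Real.pi / 2 ≤ θ - χ := by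
      by_contra! hlt
      exact hc2.not_gt (Real.cos_pos_of_mem_Ioo ⟨by linarith [Real.pi_pos], hlt⟩)
    linarith
  have hy0 : 0 < y := by
    by_contra! hy0
    nlinarith [mul_pos hB hx0]
  refine ⟨hx0, hy0, ?_⟩
  field_simp
  linarith

end Angle

/-! ### Spheres touching or enclosing given spheres -/

section Geometry

variable {V : Type*} [NormedAddCommGroup V] [InnerProductSpace ℝ V]

/-- The combination `w` of `d₁` and `d₂` is the unit vector at angle `χ` from `d₁`; the distances
from `r • w` to `d₁` and `d₂` are given by the law of cosines. -/
theorem norm_sub_of_angle {l₁ l₂ θ χ r : ℝ} (hl₁ : 0 < l₁) (hl₂ : 0 < l₂)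
    (hs : 0 < Real.sin θ) {d₁ d₂ w : V} (hd₁ : ‖d₁‖ = l₁) (hd₂ : ‖d₂‖ = l₂)
    (hd : ⟪d₁, d₂⟫_ℝ = l₁ * l₂ * Real.cos θ)
    (hw : w = (Real.sin (θ - χ) / (l₁ * Real.sin θ)) • d₁
      + (Real.sin χ / (l₂ * Real.sin θ)) • d₂) :
    ‖w‖ = 1 ∧ ‖r • w - d₁‖ ^ 2 = r ^ 2 - 2 * r * (l₁ * Real.cos χ) + l₁ ^ 2 ∧
      ‖r • w - d₂‖ ^ 2 = r ^ 2 - 2 * r * (l₂ * Real.cos (θ - χ)) + l₂ ^ 2 := by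
  have h11 : ⟪d₁, d₁⟫_ℝ = l₁ ^ 2 := by rw [real_inner_self_eq_norm_sq, hd₁]
  have h22 : ⟪d₂, d₂⟫_ℝ = l₂ ^ 2 := by rw [real_inner_self_eq_norm_sq, hd₂]
  have h21 : ⟪d₂, d₁⟫_ℝ = l₁ * l₂ * Real.cos θ := by rw [real_inner_comm, hd]
  have hcs := Real.sin_sq_add_cos_sq θ
  have hcx := Real.sin_sq_add_cos_sq χ
  have hw1 : ⟪w, d₁⟫_ℝ = l₁ * Real.cos χ := by
    rw [hw, inner_add_left, real_inner_smul_left, real_inner_smul_left, h11, h21, Real.sin_sub]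
    field_simp
    ring
  have hw2 : ⟪w, d₂⟫_ℝ = l₂ * Real.cos (θ - χ) := by
    rw [hw, inner_add_left, real_inner_smul_left, real_inner_smul_left, hd, h22, Real.sin_sub,
      Real.cos_sub]
    field_simp
    linear_combination (-Real.sin χ) * hcs
  have hww : ‖w‖ ^ 2 = 1 := by
    rw [← real_inner_self_eq_norm_sq]
    nth_rewrite 2 [hw]
    rw [inner_add_right, real_inner_smul_right, real_inner_smul_right, hw1, hw2, Real.sin_sub,
      Real.cos_sub]
    field_simp
    linear_combination Real.sin θ * hcx
  refine ⟨by nlinarith [norm_nonneg w], ?_, ?_⟩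
  · rw [norm_sub_sq_real, norm_smul, mul_pow, hww, real_inner_smul_left, hw1, hd₁,
      Real.norm_eq_abs, sq_abs]
    ring
  · rw [norm_sub_sq_real, norm_smul, mul_pow, hww, real_inner_smul_left, hw2, hd₂,
      Real.norm_eq_abs, sq_abs]
    ring

theorem exists_norm_sub_eq {x y : ℝ} {a b : V} (hx : 0 ≤ x) (hy : 0 ≤ y)
    (h : x + y = ‖a - b‖) : ∃ m : V, ‖m - a‖ = x ∧ ‖m - b‖ = y := by
  by_cases h0 : x + y = 0
  · have hab : a = b := by
      rw [← sub_eq_zero, ← norm_eq_zero, ← h, h0]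
    refine ⟨a, ?_, ?_⟩
    · simp; linarith
    · simp [hab]; linarith
  · refine ⟨a - (x / (x + y)) • (a - b), ?_, ?_⟩
    · rw [sub_sub_cancel_left, norm_neg, norm_smul, ← h, Real.norm_eq_abs,
        abs_of_nonneg (by positivity)]
      field_simp
    · rw [show a - (x / (x + y)) • (a - b) - b = (y / (x + y)) • (a - b) by
        rw [show y / (x + y) = 1 - x / (x + y) by field_simp; ring, sub_smul, one_smul]
        abel, norm_smul, ← h, Real.norm_eq_abs, abs_of_nonneg (by positivity)]
      field_simp

/-- A sphere around `c` touches three spheres; if `c` is separated from `u₀` by the line through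
`u₁` and `u₂`, then the smallest ball around the other two balls contains the first one. -/
theorem norm_sub_le_of_beyond {u₀ u₁ u₂ c m : V} {r₁ r₂ r₃ α β s δ : ℝ} (hr₁ : 0 < r₁)
    (h₁ : ‖c - u₀‖ = r₁) (h₂ : ‖c - u₁‖ = r₂) (h₃ : ‖c - u₂‖ = r₃)
    (hs : 0 ≤ s) (hpos : 0 < α + β) (hsum : s ≤ α + β)
    (hbal : α • (c - u₁) + β • (c - u₂) = s • (c - u₀))
    (hstrict : s * r₁ < α * r₂ + β * r₃) (hδ : 0 ≤ δ)
    (hm₁ : ‖m - u₁‖ = r₂ - δ) (hm₂ : ‖m - u₂‖ = r₃ - δ) : ‖m - u₀‖ ≤ r₁ - δ := by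
  obtain ⟨d, hd⟩ : ∃ d, d = m - c := ⟨_, rfl⟩
  obtain ⟨k, hk⟩ : ∃ k, k = ‖d‖ ^ 2 - δ ^ 2 := ⟨_, rfl⟩
  have hdδ : δ ≤ ‖d‖ := by
    have := norm_sub_norm_le (c - u₁) (m - u₁)
    rw [show c - u₁ - (m - u₁) = -d by rw [hd]; abel, norm_neg, h₂, hm₁] at this
    linarith
  have hk0 : 0 ≤ k := by rw [hk]; nlinarith
  -- Expanding squared distances along `d` gives the inner products with `c - u₁` and `c - u₂`;
  -- `hbal` transfers them to `c - u₀`.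
  have expand : ∀ v : V, ‖m - v‖ ^ 2 = ‖c - v‖ ^ 2 + 2 * ⟪c - v, d⟫_ℝ + ‖d‖ ^ 2 := fun v => by
    rw [← norm_add_sq_real, hd]
    congr 2
    abel
  have i₁ : ⟪c - u₁, d⟫_ℝ = -k / 2 - δ * r₂ := by
    have := expand u₁
    rw [hm₁, h₂] at this
    rw [hk]
    linarith
  have i₂ : ⟪c - u₂, d⟫_ℝ = -k / 2 - δ * r₃ := by
    have := expand u₂
    rw [hm₂, h₃] at this
    rw [hk]
    linarith
  have i₀ : s * ⟪c - u₀, d⟫_ℝ = -(k / 2 * (α + β)) - δ * (α * r₂ + β * r₃) := by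
    rw [← real_inner_smul_left, ← hbal, inner_add_left, real_inner_smul_left,
      real_inner_smul_left, i₁, i₂]
    ring
  have hδk : δ * (α * r₂ + β * r₃ - s * r₁) ≥ 0 := mul_nonneg hδ (by linarith)
  have hcs := abs_le.1 (abs_real_inner_le_norm (c - u₀) d)
  rw [h₁] at hcs
  -- If `s = 0`, then `i₀` says that a sum of nonnegative terms vanishes, which forces `m = c`.
  rcases hs.eq_or_lt with hs0 | hs0
  · subst hs0
    have hδ0 : δ = 0 := by
      rcases hδ.eq_or_lt with h | h
      · exact h.symm
      · nlinarith [mul_pos h (show 0 < α * r₂ + β * r₃ by linarith), mul_nonneg hk0 hpos.le]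
    have hk1 : k = 0 := by
      rcases hk0.eq_or_lt with h | h
      · exact h.symm
      · nlinarith [mul_pos h hpos]
    have hd0 : ‖d‖ = 0 := by
      rw [hδ0, hk1] at hk
      nlinarith
    have hmc : m = c := by rwa [norm_eq_zero, hd, sub_eq_zero] at hd0
    rw [hmc, h₁, hδ0, sub_zero]
  · have hi : ⟪c - u₀, d⟫_ℝ ≤ -k / 2 - δ * r₁ := by
      have h : s * ⟪c - u₀, d⟫_ℝ ≤ s * (-k / 2 - δ * r₁) := by
        rw [i₀]
        nlinarith [mul_nonneg hk0 (sub_nonneg.2 hsum)]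
      exact le_of_mul_le_mul_left h hs0
    -- The bound on squares yields the claim only if `r₁ - δ` is nonnegative; Cauchy–Schwarz for `c
    -- - u₀` and `d` supplies this.
    have hrδ : δ ≤ r₁ := by
      rcases hdδ.eq_or_lt with h | h
      · have hkz : k = 0 := by rw [hk, h]; ring
        have : δ = 0 := by
          rcases hδ.eq_or_lt with h' | h'
          · exact h'.symm
          · have h1 := mul_le_mul_of_nonneg_left hcs.1 hs0.le
            rw [i₀, hkz, ← h] at h1
            linarith [mul_pos h' (sub_pos.2 hstrict)]
        linarith
      · have h1 : (‖d‖ - δ) * (‖d‖ + δ) ≤ (‖d‖ - δ) * (2 * r₁) := by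
          rw [show (‖d‖ - δ) * (‖d‖ + δ) = k by rw [hk]; ring]
          linarith [hcs.1]
        have := le_of_mul_le_mul_left h1 (sub_pos.2 h)
        linarith
    refine abs_le_of_sq_le_sq' ?_ (sub_nonneg.2 hrδ) |>.2
    rw [expand u₀, h₁]
    linarith

/-- After squaring, `y² / 4` cancels and exactly `h` remains. -/
theorem norm_sub_le_of_pair {d f : V} {y e : ℝ} (hd : 0 < ‖d‖) (hy : 0 ≤ y) (he : 0 ≤ e)
    (h : ‖f‖ ^ 2 - e ^ 2 ≤ y * (⟪f, d⟫_ℝ / ‖d‖ + e)) :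
    ‖(y / (2 * ‖d‖)) • d - f‖ ≤ y / 2 + e := by
  refine abs_le_of_sq_le_sq' ?_ (by positivity) |>.2
  rw [norm_sub_sq_real, norm_smul, real_inner_smul_left, Real.norm_eq_abs,
    abs_of_nonneg (by positivity), real_inner_comm]
  have h1 : y / (2 * ‖d‖) * ‖d‖ = y / 2 := by field_simp
  have h2 : y / (2 * ‖d‖) * ⟪f, d⟫_ℝ = y / 2 * (⟪f, d⟫_ℝ / ‖d‖) := by field_simp
  rw [h1, h2]
  nlinarith

end Geometry

/-! ### Enclosing balls of pairs -/

theorem le_pairRadius_left (a b : ℝ) (x y : EuclideanSpace ℝ (Fin 3)) : a ≤ pairRadius a b x y :=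
  (le_max_left a b).trans (le_max_left _ _)

theorem le_pairRadius (a b : ℝ) (x y : EuclideanSpace ℝ (Fin 3)) :
    (a + b + ‖x - y‖) / 2 ≤ pairRadius a b x y :=
  le_max_right _ _

theorem exists_pair_center {a b : ℝ} {x y : EuclideanSpace ℝ (Fin 3)} (hba : b ≤ a) :
    ∃ c : EuclideanSpace ℝ (Fin 3),
      ‖c - x‖ ≤ pairRadius a b x y - a ∧ ‖c - y‖ ≤ pairRadius a b x y - b := by
  have h1 := le_pairRadius_left a b x y
  have h2 := le_pairRadius a b x y
  rcases le_total ‖x - y‖ (a - b) with h | h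
  · refine ⟨x, ?_, by linarith⟩
    rw [sub_self, norm_zero]
    linarith
  · obtain ⟨m, hm₁, hm₂⟩ := exists_norm_sub_eq (x := (b - a + ‖x - y‖) / 2)
      (y := (a - b + ‖x - y‖) / 2) (a := x) (b := y) (by linarith) (by linarith) (by ring)
    exact ⟨m, by linarith, by linarith⟩

/-- On the line the balls are intervals `[t k - q k, t k + q k]`. Their hull ends at the right end
of `a` and the left end of `b`; if `a = b`, that ball contains all others and any partner will do.
-/
theorem exists_pair_cover_of_line {N : ℕ} [Nontrivial (Fin N)] {q t : Fin N → ℝ}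
    {u : Fin N → EuclideanSpace ℝ (Fin 3)} {p n : EuclideanSpace ℝ (Fin 3)} (hn : ‖n‖ = 1)
    (hu : ∀ k, u k = p + t k • n) :
    ∃ i j : Fin N, i ≠ j ∧ ∃ c, ∀ k, ‖c - u k‖ ≤ pairRadius (q i) (q j) (u i) (u j) - q k := by
  obtain ⟨a, ha⟩ := Finite.exists_max fun k => t k + q k
  obtain ⟨b, hb⟩ := Finite.exists_max fun k => q k - t k
  have hcover : ∀ k, ‖p + ((t a + q a - (q b - t b)) / 2) • n - u k‖ ≤
      (t a + q a + (q b - t b)) / 2 - q k := by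
    intro k
    rw [hu k, add_sub_add_left_eq_sub, ← sub_smul, norm_smul, hn, mul_one, Real.norm_eq_abs,
      abs_le]
    have := ha k
    have := hb k
    constructor <;> linarith
  have key : ∀ i j, (t a + q a + (q b - t b)) / 2 ≤ pairRadius (q i) (q j) (u i) (u j) →
      ∃ c, ∀ k, ‖c - u k‖ ≤ pairRadius (q i) (q j) (u i) (u j) - q k := fun i j h =>
    ⟨_, fun k => (hcover k).trans (by linarith)⟩
  by_cases hab : a = b
  · obtain ⟨j, hj⟩ := exists_ne a
    refine ⟨a, j, hj.symm, key a j ?_⟩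
    subst hab
    exact le_trans (by linarith) (le_pairRadius_left _ _ _ _)
  · refine ⟨a, b, hab, key a b (le_trans ?_ (le_pairRadius _ _ _ _))⟩
    have : t a - t b ≤ ‖u a - u b‖ := by
      rw [hu a, hu b, add_sub_add_left_eq_sub, ← sub_smul, norm_smul, hn, mul_one]
      exact le_abs_self _
    linarith

/-! ### Extreme points of the intrinsic polytope -/

section ExtremePoints

variable {N : ℕ} (u : Fin N → EuclideanSpace ℝ (Fin 3))

theorem extremePoints_convexHull_range_subset :
    Set.extremePoints ℝ (convexHull ℝ (Set.range u)) ⊆ Set.range u :=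
  extremePoints_convexHull_subset

/-- Krein–Milman; no closure is needed because there are finitely many extreme points. -/
theorem convexHull_extremePoints_convexHull_range :
    convexHull ℝ (Set.extremePoints ℝ (convexHull ℝ (Set.range u))) =
      convexHull ℝ (Set.range u) := by
  have hfin := Set.finite_range u
  have h := closure_convexHull_extremePoints (hfin.isCompact_convexHull ℝ)
    (convex_convexHull ℝ (Set.range u))
  rwa [((hfin.subset (extremePoints_convexHull_range_subset u)).isClosed_convexHull ℝ).closure_eq]
    at h

theorem ncard_extremePoints_mem [NeZero N] :
    0 < (Set.extremePoints ℝ (convexHull ℝ (Set.range u))).ncard ∧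
      (Set.extremePoints ℝ (convexHull ℝ (Set.range u))).ncard ≤ N := by
  have hfin := Set.finite_range u
  have hsub := extremePoints_convexHull_range_subset u
  refine ⟨?_, ?_⟩
  · rw [Set.ncard_pos (hfin.subset hsub)]
    exact (hfin.isCompact_convexHull ℝ).extremePoints_nonempty
      ((Set.range_nonempty u).convexHull)
  · refine (Set.ncard_le_ncard hsub hfin).trans ?_
    rw [← Set.image_univ]
    refine (Set.ncard_image_le Set.finite_univ).trans ?_
    simp

theorem eq_of_ncard_extremePoints_eq_one
    (h : (Set.extremePoints ℝ (convexHull ℝ (Set.range u))).ncard = 1) (i j : Fin N) :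
    u i = u j := by
  obtain ⟨p, hp⟩ := Set.ncard_eq_one.1 h
  have hP := convexHull_extremePoints_convexHull_range u
  rw [hp, convexHull_singleton] at hP
  have : ∀ k, u k = p := fun k => by
    have := subset_convexHull ℝ (Set.range u) ⟨k, rfl⟩
    rwa [← hP] at this
  rw [this i, this j]

theorem exists_line_of_ncard_extremePoints_eq_two
    (h : (Set.extremePoints ℝ (convexHull ℝ (Set.range u))).ncard = 2) :
    ∃ (p n : EuclideanSpace ℝ (Fin 3)) (t : Fin N → ℝ), ‖n‖ = 1 ∧ ∀ k, u k = p + t k • n := by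
  obtain ⟨p, r, hpr, hS⟩ := Set.ncard_eq_two.1 h
  have hP := convexHull_extremePoints_convexHull_range u
  rw [hS, convexHull_pair] at hP
  have hne : ‖r - p‖ ≠ 0 := by
    rw [norm_ne_zero_iff, sub_ne_zero]
    exact hpr.symm
  have hk : ∀ k, ∃ s : ℝ, u k = p + s • (r - p) := fun k => by
    have := subset_convexHull ℝ (Set.range u) ⟨k, rfl⟩
    rw [← hP, segment_eq_image'] at this
    obtain ⟨s, -, hs⟩ := this
    exact ⟨s, hs.symm⟩
  choose s hs using hk
  refine ⟨p, ‖r - p‖⁻¹ • (r - p), fun k => s k * ‖r - p‖, ?_, fun k => ?_⟩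
  · rw [norm_smul, norm_inv, norm_norm, inv_mul_cancel₀ hne]
  · rw [hs k, smul_smul, mul_assoc, mul_inv_cancel₀ hne, mul_one]

/-- All three points are distinct and extreme, whereas collinearity would put one of them between
the others. -/
theorem not_collinear_of_ncard_extremePoints_eq_three (u : Fin 3 → EuclideanSpace ℝ (Fin 3))
    (h : (Set.extremePoints ℝ (convexHull ℝ (Set.range u))).ncard = 3) :
    ¬ Collinear ℝ {u 1, u 0, u 2} := by
  have hfin := Set.finite_range u
  have hsub := extremePoints_convexHull_range_subset u
  have hcard : (Set.range u).ncard ≤ 3 := by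
    rw [← Set.image_univ]
    refine (Set.ncard_image_le Set.finite_univ).trans ?_
    simp
  have hS := Set.eq_of_subset_of_ncard_le hsub (by omega) hfin
  have hinj : Function.Injective u := by
    rw [← Set.injOn_univ, ← Set.ncard_image_iff Set.finite_univ, Set.image_univ, ← hS, h]
    simp
  have hext : ∀ i j k : Fin 3, j ≠ i → k ≠ i → ¬ Wbtw ℝ (u j) (u i) (u k) := by
    intro i j k hj hk hw
    have hmem : u i ∈ Set.extremePoints ℝ (convexHull ℝ (Set.range u)) := by
      rw [hS]
      exact ⟨i, rfl⟩
    rw [mem_extremePoints_iff_forall_segment] at hmem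
    rcases hmem.2 (u j) (subset_convexHull ℝ _ ⟨j, rfl⟩) (u k) (subset_convexHull ℝ _ ⟨k, rfl⟩)
      (mem_segment_iff_wbtw.2 hw) with h' | h'
    · exact hj (hinj h')
    · exact hk (hinj h')
  intro hcol
  rcases hcol.wbtw_or_wbtw_or_wbtw with h' | h' | h'
  · exact hext 0 1 2 (by decide) (by decide) h'
  · exact hext 2 0 1 (by decide) (by decide) h'
  · exact hext 1 2 0 (by decide) (by decide) h'

end ExtremePoints

/-- A sphere touching all the spheres of radii `q i` around the weighted Bloch vectors, whose
center is a suitable convex combination, yields an optimal measurement. -/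
theorem isOptimalPOVM_of_touching {N : ℕ} {q p : Fin N → ℝ}
    {ρ : Fin N → Matrix (Fin 2) (Fin 2) ℂ} (hρ : ∀ i, IsDensityMatrix (ρ i))
    {w : Fin N → EuclideanSpace ℝ (Fin 3)} {c : EuclideanSpace ℝ (Fin 3)} {R : ℝ}
    (hp : ∀ i, 0 ≤ p i) (hw : ∀ i, ‖w i‖ = 1)
    (hsum : ∑ i, p i = 1) (hbal : ∑ i, p i • w i = 0) (hR : ∀ i, q i ≤ R)
    (hc : ∀ i, c - weightedBloch q ρ i = (R - q i) • w i) :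
    IsGreatest (correctProbs q ρ) R ∧
      IsOptimalPOVM q ρ fun i => (p i : ℂ) • (1 - pauliDot (w i)) := by
  simp only [one_sub_pauliDot]
  have hw' : ∀ i, ‖-w i‖ ≤ 1 := fun i => by rw [norm_neg, hw i]
  have hM := isPOVM_smul_one_add_pauliDot (w := fun i => -w i) hp hw' hsum
    (by simp only [smul_neg, Finset.sum_neg_distrib, hbal, neg_zero])
  have hval : correctProb q ρ (fun i => (p i : ℂ) • (1 + pauliDot (-w i))) = R := by
    rw [correctProb_smul_one_add_pauliDot hρ hp hw']
    -- Each term equals `R * p i` up to a pairing with `c`, which `hbal` cancels in the sum.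
    have hterm : ∀ i, p i * (q i + ⟪weightedBloch q ρ i, -w i⟫_ℝ) =
        R * p i - ⟪c, p i • w i⟫_ℝ := fun i => by
      have h1 : weightedBloch q ρ i = c - (R - q i) • w i := by
        rw [← hc i]
        abel
      rw [h1, inner_neg_right, inner_sub_left, real_inner_smul_left, real_inner_self_eq_norm_sq,
        hw i, real_inner_smul_right]
      ring
    simp only [hterm]
    rw [Finset.sum_sub_distrib, ← Finset.mul_sum, hsum, ← inner_sum, hbal, inner_zero_right]
    ring
  have hg : IsGreatest (correctProbs q ρ) R := by
    refine isGreatest_correctProbs hρ ⟨_, hM, hval.symm⟩ (c := c) fun i => ?_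
    rw [hc i, norm_smul, hw i, mul_one, Real.norm_eq_abs, abs_of_nonneg (sub_nonneg.2 (hR i))]
  refine ⟨hg, hM, fun M' hM' => ?_⟩
  rw [hval]
  exact hg.2 ⟨M', hM', rfl⟩

/-! ### The nondegenerate triangle -/

section Triangle

variable {u : Fin 3 → EuclideanSpace ℝ (Fin 3)} {q : Fin 3 → ℝ} {l₁ l₂ e₁ e₂ θ θ₂ χ r : ℝ}

theorem triangle_nondegenerate (hl₁ : l₁ = ‖u 1 - u 0‖) (hl₂ : l₂ = ‖u 2 - u 0‖)
    (hθ : θ = EuclideanGeometry.angle (u 1) (u 0) (u 2)) (h : ¬ Collinear ℝ {u 1, u 0, u 2}) :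
    0 < l₁ ∧ 0 < l₂ ∧ 0 < θ ∧ θ < Real.pi ∧
      ⟪u 1 - u 0, u 2 - u 0⟫_ℝ = l₁ * l₂ * Real.cos θ := by
  rw [EuclideanGeometry.collinear_iff_eq_or_eq_or_sin_eq_zero, ← hθ] at h
  push Not at h
  obtain ⟨h₁, h₂, hs⟩ := h
  have h0 : 0 ≤ θ := hθ ▸ EuclideanGeometry.angle_nonneg _ _ _
  have hπ : θ ≤ Real.pi := hθ ▸ EuclideanGeometry.angle_le_pi _ _ _
  refine ⟨?_, ?_, ?_, ?_, ?_⟩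
  · rw [hl₁, norm_pos_iff, sub_ne_zero]
    exact h₁
  · rw [hl₂, norm_pos_iff, sub_ne_zero]
    exact h₂
  · refine h0.lt_of_ne fun h => hs ?_
    rw [← h, Real.sin_zero]
  · refine hπ.lt_of_ne fun h => hs ?_
    rw [h, Real.sin_pi]
  · have h := InnerProductGeometry.cos_angle_mul_norm_mul_norm (u 1 - u 0) (u 2 - u 0)
    rw [show InnerProductGeometry.angle (u 1 - u 0) (u 2 - u 0) = θ from hθ.symm, ← hl₁, ← hl₂]
      at h
    linarith

/-- By the law of cosines, distance `r + e₁` to `u 1` amounts to `2 r (l₁ cos χ + e₁) = l₁² - e₁²`,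
and similarly for `u 2`; the balance equation makes one `r` satisfy both. -/
theorem touching_center (hl₁ : 0 < l₁) (hl₂ : 0 < l₂) (he₁ : 0 ≤ e₁) (he₂ : 0 ≤ e₂)
    (hθ : 0 < θ) (hθπ : θ < Real.pi) (hd₁ : ‖u 1 - u 0‖ = l₁) (hd₂ : ‖u 2 - u 0‖ = l₂)
    (hd : ⟪u 1 - u 0, u 2 - u 0⟫_ℝ = l₁ * l₂ * Real.cos θ) (h₁ : e₁ < l₁) (h₂ : e₂ < l₂)
    (hb₁ : (l₁ * Real.cos θ + e₁) / (l₁ + e₁) < (l₁ - e₁) / (l₂ - e₂))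
    (hb₂ : (l₂ * Real.cos θ + e₂) / (l₂ + e₂) < (l₂ - e₂) / (l₁ - e₁))
    (hχ : χ = chi l₁ l₂ e₁ e₂ θ)
    (hr : r = (l₁ ^ 2 - e₁ ^ 2) / (2 * (l₁ * Real.cos χ + e₁))) :
    0 < χ ∧ χ < θ ∧ 0 < r ∧ ‖optDir₁ u l₁ l₂ θ χ‖ = 1 ∧
      ‖r • optDir₁ u l₁ l₂ θ χ - (u 1 - u 0)‖ = r + e₁ ∧
      ‖r • optDir₁ u l₁ l₂ θ χ - (u 2 - u 0)‖ = r + e₂ := by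
  obtain ⟨hχ0, hχθ, hbal⟩ := chi_mem_and_balance hl₁ hl₂ he₁ he₂ hθ hθπ h₁ h₂ hb₁ hb₂
  rw [← hχ] at hχ0 hχθ hbal
  have hA : 0 < l₁ ^ 2 - e₁ ^ 2 := by nlinarith
  have hB : 0 < l₂ ^ 2 - e₂ ^ 2 := by nlinarith
  obtain ⟨hx, hy, hxy⟩ := radius_pos_and_eq hl₁ hl₂ he₁ he₂ hθπ hA hB hχ0 hχθ rfl rfl hbal
  have hr0 : 0 < r := by rw [hr]; positivity
  obtain ⟨hw, hw₁, hw₂⟩ := norm_sub_of_angle (r := r) (χ := χ) hl₁ hl₂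
    (Real.sin_pos_of_pos_of_lt_pi hθ hθπ) hd₁ hd₂ hd (w := optDir₁ u l₁ l₂ θ χ) rfl
  have hr₁ : r * (2 * (l₁ * Real.cos χ + e₁)) = l₁ ^ 2 - e₁ ^ 2 := by
    rw [hr]
    field_simp
  have hr₂ : r * (2 * (l₂ * Real.cos (θ - χ) + e₂)) = l₂ ^ 2 - e₂ ^ 2 := by
    rw [hr, hxy]
    field_simp
  refine ⟨hχ0, hχθ, hr0, hw, ?_, ?_⟩
  · refine (sq_eq_sq₀ (norm_nonneg _) (by positivity)).1 ?_
    rw [hw₁]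
    linarith
  · refine (sq_eq_sq₀ (norm_nonneg _) (by positivity)).1 ?_
    rw [hw₂]
    linarith

theorem smul_optDir₁ (hl₁ : l₁ ≠ 0) (hl₂ : l₂ ≠ 0) (hs : Real.sin θ ≠ 0) :
    (l₁ * l₂ * Real.sin θ) • optDir₁ u l₁ l₂ θ χ =
      (l₂ * Real.sin (θ - χ)) • (u 1 - u 0) + (l₁ * Real.sin χ) • (u 2 - u 0) := by
  rw [optDir₁, smul_add, smul_smul, smul_smul]
  congr 2 <;> field_simp

/-- The distance from `u 0`, in the direction at angle `χ` from the first side, to the opposite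
side of the triangle. -/
theorem opposite_side_distance (hl₁ : 0 < l₁) (hl₂ : 0 < l₂) (hθ : 0 < θ) (hθπ : θ < Real.pi)
    (hd₁ : ‖u 1 - u 0‖ = l₁) (hd₂ : ‖u 2 - u 0‖ = l₂)
    (hd : ⟪u 1 - u 0, u 2 - u 0⟫_ℝ = l₁ * l₂ * Real.cos θ)
    (hθ₂ : θ₂ = EuclideanGeometry.angle (u 0) (u 1) (u 2)) :
    l₁ * Real.sin θ₂ / Real.sin (χ + θ₂) =
      l₁ * l₂ * Real.sin θ / (l₁ * Real.sin χ + l₂ * Real.sin (θ - χ)) := by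
  have hs := Real.sin_pos_of_pos_of_lt_pi hθ hθπ
  have hcs := Real.sin_sq_add_cos_sq θ
  have hcs₂ := Real.sin_sq_add_cos_sq θ₂
  obtain ⟨l₃, hl₃⟩ : ∃ l₃, l₃ = ‖u 2 - u 1‖ := ⟨_, rfl⟩
  have hv : u 2 - u 1 = (u 2 - u 0) - (u 1 - u 0) := by abel
  have hl₃sq : l₃ ^ 2 = l₁ ^ 2 + l₂ ^ 2 - 2 * l₁ * l₂ * Real.cos θ := by
    rw [hl₃, hv, norm_sub_sq_real, hd₁, hd₂, real_inner_comm, hd]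
    ring
  have hl₃0 : 0 < l₃ := by
    have h : 0 < l₃ ^ 2 := by
      have : l₃ ^ 2 = (l₁ - l₂ * Real.cos θ) ^ 2 + (l₂ * Real.sin θ) ^ 2 := by
        rw [hl₃sq]
        linear_combination (-(l₂ ^ 2)) * hcs
      rw [this]
      positivity
    refine lt_of_le_of_ne (hl₃ ▸ norm_nonneg _) fun h0 => ?_
    rw [← h0] at h
    simp at h
  have hcos : l₃ * Real.cos θ₂ = l₁ - l₂ * Real.cos θ := by
    have h := InnerProductGeometry.cos_angle_mul_norm_mul_norm (u 0 - u 1) (u 2 - u 1)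
    rw [← hl₃, norm_sub_rev (u 0), hd₁, show InnerProductGeometry.angle (u 0 - u 1) (u 2 - u 1) = θ₂
      from hθ₂.symm, hv, ← neg_sub (u 1) (u 0), inner_neg_left, inner_sub_right, hd,
      real_inner_self_eq_norm_sq, hd₁] at h
    refine mul_left_cancel₀ hl₁.ne' ?_
    linarith
  have hsin : l₃ * Real.sin θ₂ = l₂ * Real.sin θ := by
    have h0 : 0 ≤ Real.sin θ₂ := hθ₂ ▸ InnerProductGeometry.sin_angle_nonneg _ _
    refine (sq_eq_sq₀ (by positivity) (by positivity)).1 ?_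
    linear_combination l₃ ^ 2 * hcs₂ + hl₃sq - l₂ ^ 2 * hcs
      - (l₃ * Real.cos θ₂ + (l₁ - l₂ * Real.cos θ)) * hcos
  have hsum : l₃ * Real.sin (χ + θ₂) = l₁ * Real.sin χ + l₂ * Real.sin (θ - χ) := by
    rw [Real.sin_add, Real.sin_sub]
    linear_combination Real.sin χ * hcos + Real.cos χ * hsin
  rw [← hsum, mul_assoc l₁ l₂, ← hsin, mul_left_comm l₁ l₃, mul_div_mul_left _ _ hl₃0.ne']

/-- `hin` is the nonnegativity of the first weight, which is condition (c) in weak form; the other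
two weights are positive since `0 < χ < θ`. -/
theorem optimal_of_inside {ρ : Fin 3 → Matrix (Fin 2) (Fin 2) ℂ}
    (hρ : ∀ i, IsDensityMatrix (ρ i)) (hu : u = weightedBloch q ρ)
    (hl₁ : 0 < l₁) (hl₂ : 0 < l₂) (he₁ : 0 ≤ e₁) (he₂ : 0 ≤ e₂)
    (he₁q : e₁ = q 0 - q 1) (he₂q : e₂ = q 0 - q 2) (hθ : 0 < θ) (hθπ : θ < Real.pi)
    (hχ : 0 < χ) (hχθ : χ < θ) (hr : 0 < r) (hw : ‖optDir₁ u l₁ l₂ θ χ‖ = 1)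
    (hw₁ : ‖r • optDir₁ u l₁ l₂ θ χ - (u 1 - u 0)‖ = r + e₁)
    (hw₂ : ‖r • optDir₁ u l₁ l₂ θ χ - (u 2 - u 0)‖ = r + e₂)
    (hin : r * (l₁ * Real.sin χ + l₂ * Real.sin (θ - χ)) ≤ l₁ * l₂ * Real.sin θ) :
    IsGreatest (correctProbs q ρ) (q 0 + r) ∧
      IsOptimalPOVM q ρ (fun i => (optWeight l₁ l₂ e₁ e₂ θ χ r i : ℂ) •
        (1 - pauliDot (optDir u l₁ l₂ e₁ e₂ θ χ r i))) := by
  have hs := Real.sin_pos_of_pos_of_lt_pi hθ hθπ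
  have hα : 0 < l₂ * Real.sin (θ - χ) :=
    mul_pos hl₂ (Real.sin_pos_of_pos_of_lt_pi (by linarith) (by linarith))
  have hβ : 0 < l₁ * Real.sin χ := mul_pos hl₁ (Real.sin_pos_of_pos_of_lt_pi hχ (by linarith))
  have hT : 0 < l₁ * l₂ * Real.sin θ := by positivity
  have hbary := smul_optDir₁ (u := u) (χ := χ) hl₁.ne' hl₂.ne' hs.ne'
  obtain ⟨E, hE⟩ : ∃ E, E = l₁ * l₂ * Real.sin θ + e₂ * l₁ * Real.sin χ
    + e₁ * l₂ * Real.sin (θ - χ) := ⟨_, rfl⟩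
  have hE0 : 0 < E := by
    rw [hE]
    nlinarith [mul_nonneg he₁ hα.le, mul_nonneg he₂ hβ.le]
  have hr₁ : 0 < r + e₁ := by linarith
  have hr₂ : 0 < r + e₂ := by linarith
  refine isOptimalPOVM_of_touching hρ (c := u 0 + r • optDir₁ u l₁ l₂ θ χ) ?_ ?_ ?_ ?_ ?_ ?_
  · intro i
    fin_cases i <;> simp only [optWeight, ← hE]
    · exact div_nonneg (by linarith) hE0.le
    · refine div_nonneg ?_ hE0.le
      rw [mul_assoc]
      positivity
    · refine div_nonneg ?_ hE0.le
      rw [mul_assoc]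
      positivity
  · intro i
    fin_cases i <;> simp only [optDir]
    · exact hw
    · refine (norm_smul _ _).trans ?_
      rw [hw₁, norm_inv, Real.norm_eq_abs, abs_of_pos hr₁, inv_mul_cancel₀ hr₁.ne']
    · refine (norm_smul _ _).trans ?_
      rw [hw₂, norm_inv, Real.norm_eq_abs, abs_of_pos hr₂, inv_mul_cancel₀ hr₂.ne']
  · simp only [Fin.sum_univ_three, optWeight, ← hE, Matrix.cons_val]
    rw [← add_div, ← add_div, div_eq_one_iff_eq hE0.ne', hE]
    ring
  · simp only [Fin.sum_univ_three, optWeight, optDir, ← hE, Matrix.cons_val]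
    rw [smul_smul, smul_smul,
      show (r + e₁) * l₂ * Real.sin (θ - χ) / E * (r + e₁)⁻¹ = E⁻¹ * (l₂ * Real.sin (θ - χ)) by
        field_simp,
      show (r + e₂) * l₁ * Real.sin χ / E * (r + e₂)⁻¹ = E⁻¹ * (l₁ * Real.sin χ) by field_simp,
      div_eq_inv_mul]
    -- The multiples of `r` cancel, leaving the expression of `optDir₁` in the two sides.
    linear_combination (norm := module) E⁻¹ • hbary
  · intro i
    fin_cases i <;> simp <;> linarith
  · intro i
    rw [← hu]
    fin_cases i <;> simp only [optDir, Fin.mk_one, Fin.zero_eta, Fin.reduceFinMk, Matrix.cons_val]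
    · rw [add_sub_cancel_left, add_sub_cancel_left]
    · rw [smul_smul, show q 0 + r - q 1 = r + e₁ by linarith, mul_inv_cancel₀ hr₁.ne', one_smul]
      abel
    · rw [smul_smul, show q 0 + r - q 2 = r + e₂ by linarith, mul_inv_cancel₀ hr₂.ne', one_smul]
      abel

/-- The touching ball has radius `q 0 + r`. With `c` on or beyond the edge it can be shrunk by `δ`
to the enclosing ball of the balls `1`, `2`, centered at `m` and still containing ball `0`. -/
theorem exists_cover_of_outside
    (hl₁ : 0 < l₁) (hl₂ : 0 < l₂) (he₁ : 0 ≤ e₁) (he₂ : 0 ≤ e₂)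
    (he₁q : e₁ = q 0 - q 1) (he₂q : e₂ = q 0 - q 2) (hθ : 0 < θ) (hθπ : θ < Real.pi)
    (hχ : 0 < χ) (hχθ : χ < θ) (hr : 0 < r) (hw : ‖optDir₁ u l₁ l₂ θ χ‖ = 1)
    (hw₁ : ‖r • optDir₁ u l₁ l₂ θ χ - (u 1 - u 0)‖ = r + e₁)
    (hw₂ : ‖r • optDir₁ u l₁ l₂ θ χ - (u 2 - u 0)‖ = r + e₂)
    (hout : l₁ * l₂ * Real.sin θ ≤ r * (l₁ * Real.sin χ + l₂ * Real.sin (θ - χ))) :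
    ∃ c, ∀ k, ‖c - u k‖ ≤ pairRadius (q 1) (q 2) (u 1) (u 2) - q k := by
  have hs := Real.sin_pos_of_pos_of_lt_pi hθ hθπ
  have hα : 0 < l₂ * Real.sin (θ - χ) :=
    mul_pos hl₂ (Real.sin_pos_of_pos_of_lt_pi (by linarith) (by linarith))
  have hβ : 0 < l₁ * Real.sin χ := mul_pos hl₁ (Real.sin_pos_of_pos_of_lt_pi hχ (by linarith))
  have hT : 0 < l₁ * l₂ * Real.sin θ := by positivity
  have hbary := smul_optDir₁ (u := u) (χ := χ) hl₁.ne' hl₂.ne' hs.ne'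
  obtain ⟨w, hwdef⟩ : ∃ w, w = optDir₁ u l₁ l₂ θ χ := ⟨_, rfl⟩
  rw [← hwdef] at hw hw₁ hw₂ hbary
  obtain ⟨c, hc⟩ : ∃ c, c = u 0 + r • w := ⟨_, rfl⟩
  have hc₀ : c - u 0 = r • w := by rw [hc]; abel
  have hc₁ : c - u 1 = r • w - (u 1 - u 0) := by rw [hc]; abel
  have hc₂ : c - u 2 = r • w - (u 2 - u 0) := by rw [hc]; abel
  have hn₀ : ‖c - u 0‖ = r := by rw [hc₀, norm_smul, hw, mul_one, Real.norm_eq_abs, abs_of_pos hr]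
  rw [← hc₁] at hw₁
  rw [← hc₂] at hw₂
  have t₁ : ‖u 1 - u 2‖ ≤ (r + e₁) + (r + e₂) := by
    rw [← hw₁, ← hw₂]
    have := norm_sub_le (c - u 2) (c - u 1)
    rw [sub_sub_sub_cancel_left] at this
    linarith
  have t₂ : |(r + e₂) - (r + e₁)| ≤ ‖u 1 - u 2‖ := by
    rw [← hw₁, ← hw₂]
    have := abs_norm_sub_norm_le (c - u 2) (c - u 1)
    rwa [sub_sub_sub_cancel_left] at this
  rw [abs_le] at t₂
  obtain ⟨δ, hδ⟩ : ∃ δ, δ = ((r + e₁) + (r + e₂) - ‖u 1 - u 2‖) / 2 := ⟨_, rfl⟩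
  obtain ⟨m, hm₁, hm₂⟩ := exists_norm_sub_eq (x := r + e₁ - δ) (y := r + e₂ - δ) (a := u 1)
    (b := u 2) (by linarith) (by linarith) (by linarith)
  -- `s` is read off from `smul_optDir₁`: `α (c - u 1) + β (c - u 2)` is `((α + β) r - l₁ l₂ sin θ)
  -- w`, and `c - u 0 = r w`.
  have hm₀ := norm_sub_le_of_beyond (α := l₂ * Real.sin (θ - χ)) (β := l₁ * Real.sin χ)
    (s := l₁ * Real.sin χ + l₂ * Real.sin (θ - χ) - l₁ * l₂ * Real.sin θ / r) (δ := δ)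
    hr hn₀ hw₁ hw₂ (by rw [sub_nonneg, div_le_iff₀ hr]; linarith) (by positivity)
    (by linarith [div_pos hT hr])
    (by
      rw [hc₀, hc₁, hc₂, smul_smul, sub_mul, div_mul_cancel₀ _ hr.ne']
      linear_combination (norm := module) hbary)
    (by
      rw [sub_mul, div_mul_cancel₀ _ hr.ne']
      nlinarith [mul_nonneg he₁ hα.le, mul_nonneg he₂ hβ.le]) (by linarith) hm₁ hm₂
  have hR := le_pairRadius (q 1) (q 2) (u 1) (u 2)
  refine ⟨m, fun k => ?_⟩
  fin_cases k <;> simp only [Fin.mk_one, Fin.zero_eta, Fin.reduceFinMk] <;> linarith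

/-- For `C` the cosine of the angle at `a`, `hle` is the negation of an inequality of (b) with
denominators cleared. The center is at distance `(l - (qa - qb)) / 2` from `a` towards `b`. -/
theorem pair_norm_sub_le {a b f : EuclideanSpace ℝ (Fin 3)} {qa qb l s e : ℝ} (hl : 0 < l)
    (hab : ‖b - a‖ = l)
    (h : qa - qb < l) (he : 0 ≤ e) (hf : ‖f - a‖ = s) {C : ℝ}
    (hin : ⟪f - a, b - a⟫_ℝ = s * l * C)
    (hle : s ^ 2 - e ^ 2 ≤ (l - (qa - qb)) * (s * C + e)) (hq : qb ≤ qa) :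
    ∃ c : EuclideanSpace ℝ (Fin 3),
      ‖c - a‖ ≤ pairRadius qa qb a b - qa ∧
      ‖c - b‖ ≤ pairRadius qa qb a b - qb ∧
      ‖c - f‖ ≤ pairRadius qa qb a b - qa + e := by
  have hR := le_pairRadius qa qb a b
  rw [norm_sub_rev, hab] at hR
  have hy : 0 ≤ l - (qa - qb) := by linarith
  obtain ⟨t, ht⟩ : ∃ t, t = (l - (qa - qb)) / (2 * l) := ⟨_, rfl⟩
  have htl : t * l = (l - (qa - qb)) / 2 := by rw [ht]; field_simp
  have ht0 : 0 ≤ t := by rw [ht]; positivity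
  have ht1 : t ≤ 1 := by rw [ht, div_le_one (by positivity)]; linarith
  refine ⟨a + t • (b - a), ?_, ?_, ?_⟩
  · rw [add_sub_cancel_left, norm_smul, hab, Real.norm_eq_abs, abs_of_nonneg ht0]
    linarith
  · rw [show a + t • (b - a) - b = (-(1 - t)) • (b - a) by module, norm_smul, hab, norm_neg,
      Real.norm_eq_abs, abs_of_nonneg (by linarith)]
    linarith
  · have hcov := norm_sub_le_of_pair (d := b - a) (f := f - a) (y := l - (qa - qb)) (e := e)
      (by rw [hab]; exact hl) hy he
      (by rw [hf, hin, hab, show s * l * C / l = s * C by field_simp]; exact hle)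
    rw [hab, ← ht] at hcov
    rw [show a + t • (b - a) - f = t • (b - a) - (f - a) by abel]
    linarith

theorem exists_pair_cover_of_not_triangleConditions
    (hl₁ : 0 < l₁) (hl₂ : 0 < l₂) (he₁ : 0 ≤ e₁) (he₂ : 0 ≤ e₂)
    (he₁q : e₁ = q 0 - q 1) (he₂q : e₂ = q 0 - q 2) (hθ : 0 < θ) (hθπ : θ < Real.pi)
    (hd₁ : ‖u 1 - u 0‖ = l₁) (hd₂ : ‖u 2 - u 0‖ = l₂)
    (hd : ⟪u 1 - u 0, u 2 - u 0⟫_ℝ = l₁ * l₂ * Real.cos θ)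
    (hθ₂ : θ₂ = EuclideanGeometry.angle (u 0) (u 1) (u 2)) (hχ : χ = chi l₁ l₂ e₁ e₂ θ)
    (hnot : ¬ TriangleConditions l₁ l₂ e₁ e₂ θ θ₂ χ) :
    ∃ i j : Fin 3, i ≠ j ∧ ∃ c, ∀ k, ‖c - u k‖ ≤ pairRadius (q i) (q j) (u i) (u j) - q k := by
  by_cases h₁ : e₁ < l₁
  swap
  -- Ball `1` lies inside ball `0`, so whatever encloses balls `0` and `2` encloses it.
  · obtain ⟨c, hc₀, hc₂⟩ := exists_pair_center (x := u 0) (y := u 2) (show q 2 ≤ q 0 by linarith)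
    refine ⟨0, 2, by decide, c, fun k => ?_⟩
    have := norm_sub_le_norm_sub_add_norm_sub c (u 0) (u 1)
    rw [norm_sub_rev (u 0), hd₁] at this
    fin_cases k <;> simp only [Fin.mk_one, Fin.zero_eta, Fin.reduceFinMk] <;> linarith
  by_cases h₂ : e₂ < l₂
  swap
  · obtain ⟨c, hc₀, hc₁⟩ := exists_pair_center (x := u 0) (y := u 1) (show q 1 ≤ q 0 by linarith)
    refine ⟨0, 1, by decide, c, fun k => ?_⟩
    have := norm_sub_le_norm_sub_add_norm_sub c (u 0) (u 2)
    rw [norm_sub_rev (u 0), hd₂] at this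
    fin_cases k <;> simp only [Fin.mk_one, Fin.zero_eta, Fin.reduceFinMk] <;> linarith
  by_cases hb₁ : (l₁ * Real.cos θ + e₁) / (l₁ + e₁) < (l₁ - e₁) / (l₂ - e₂)
  swap
  · rw [not_lt, div_le_div_iff₀ (by linarith) (by linarith)] at hb₁
    obtain ⟨c, hc₀, hc₂, hc₁⟩ := pair_norm_sub_le (qa := q 0) (qb := q 2) (e := e₁) hl₂ hd₂
      (by linarith) he₁ hd₁ hd (by rw [← he₂q]; linarith) (by linarith)
    refine ⟨0, 2, by decide, c, fun k => ?_⟩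
    fin_cases k <;> simp only [Fin.mk_one, Fin.zero_eta, Fin.reduceFinMk] <;> linarith
  by_cases hb₂ : (l₂ * Real.cos θ + e₂) / (l₂ + e₂) < (l₂ - e₂) / (l₁ - e₁)
  swap
  · rw [not_lt, div_le_div_iff₀ (by linarith) (by linarith)] at hb₂
    obtain ⟨c, hc₀, hc₁, hc₂⟩ := pair_norm_sub_le (qa := q 0) (qb := q 1) (e := e₂)
      (C := Real.cos θ) hl₁ hd₁ (by linarith) he₂ hd₂ (by rw [real_inner_comm, hd]; ring)
      (by rw [← he₁q]; linarith) (by linarith)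
    refine ⟨0, 1, by decide, c, fun k => ?_⟩
    fin_cases k <;> simp only [Fin.mk_one, Fin.zero_eta, Fin.reduceFinMk] <;> linarith
  obtain ⟨hχ0, hχθ, hr, hw, hw₁, hw₂⟩ :=
    touching_center hl₁ hl₂ he₁ he₂ hθ hθπ hd₁ hd₂ hd h₁ h₂ hb₁ hb₂ hχ rfl
  refine ⟨1, 2, by decide, exists_cover_of_outside hl₁ hl₂ he₁ he₂ he₁q he₂q hθ hθπ hχ0 hχθ hr hw
    hw₁ hw₂ ?_⟩
  have hnc : ¬ _ := fun h => hnot ⟨⟨h₁, h₂⟩, ⟨hb₁, hb₂⟩, h⟩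
  rw [opposite_side_distance hl₁ hl₂ hθ hθπ hd₁ hd₂ hd hθ₂, not_lt, div_le_iff₀] at hnc
  · exact hnc
  · exact add_pos (mul_pos hl₁ (Real.sin_pos_of_pos_of_lt_pi hχ0 (by linarith)))
      (mul_pos hl₂ (Real.sin_pos_of_pos_of_lt_pi (by linarith) (by linarith)))

end Triangle

end QSD

end

theorem lemma2 (q : Fin 3 → ℝ) (ρ : Fin 3 → Matrix (Fin 2) (Fin 2) ℂ)
    (hq_nonneg : ∀ i, 0 ≤ q i) (hq_sum : ∑ i, q i = 1) (hq_order : q 0 ≥ q 1 ∧ q 1 ≥ q 2)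
    (hρ : ∀ i, QSD.IsDensityMatrix (ρ i))
    (u : Fin 3 → EuclideanSpace ℝ (Fin 3)) (hu : u = QSD.weightedBloch q ρ)
    (l₁ l₂ e₁ e₂ θ₁ θ₂ χ r₁ : ℝ)
    (hl₁ : l₁ = ‖u 1 - u 0‖) (hl₂ : l₂ = ‖u 2 - u 0‖)
    (he₁ : e₁ = q 0 - q 1) (he₂ : e₂ = q 0 - q 2)
    (hθ₁ : θ₁ = EuclideanGeometry.angle (u 1) (u 0) (u 2))
    (hθ₂ : θ₂ = EuclideanGeometry.angle (u 0) (u 1) (u 2))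
    (hχ : χ = QSD.chi l₁ l₂ e₁ e₂ θ₁)
    (hr₁ : r₁ = (l₁ ^ 2 - e₁ ^ 2) / (2 * (l₁ * Real.cos χ + e₁))) :
    -- the guessing probability is attained
    IsGreatest (QSD.correctProbs q ρ) (QSD.guessProb q ρ) ∧
    -- the cases are exhaustive
    (QSD.numExtremePoints q ρ = 1 ∨ QSD.numExtremePoints q ρ = 2 ∨
      QSD.numExtremePoints q ρ = 3) ∧
    -- case (i)
    (QSD.numExtremePoints q ρ = 1 → QSD.guessProb q ρ = q 0) ∧
    -- case (ii)
    ((QSD.numExtremePoints q ρ = 2 ∨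
        (QSD.numExtremePoints q ρ = 3 ∧ ¬ QSD.TriangleConditions l₁ l₂ e₁ e₂ θ₁ θ₂ χ)) →
      IsGreatest (QSD.helstromValues q ρ) (QSD.guessProb q ρ)) ∧
    -- case (iii)
    (QSD.numExtremePoints q ρ = 3 ∧ QSD.TriangleConditions l₁ l₂ e₁ e₂ θ₁ θ₂ χ →
      QSD.guessProb q ρ = q 0 + (l₁ ^ 2 - e₁ ^ 2) / (2 * (l₁ * Real.cos χ + e₁)) ∧
      QSD.IsOptimalPOVM q ρ (fun i =>
        (QSD.optWeight l₁ l₂ e₁ e₂ θ₁ χ r₁ i : ℂ) •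
          (1 - QSD.pauliDot (QSD.optDir u l₁ l₂ e₁ e₂ θ₁ χ r₁ i)))) := by
  have hcount : QSD.numExtremePoints q ρ =
      (Set.extremePoints ℝ (convexHull ℝ (Set.range u))).ncard := by
    rw [hu, QSD.numExtremePoints, QSD.intrinsicPolytope]
  have hex : QSD.numExtremePoints q ρ = 1 ∨ QSD.numExtremePoints q ρ = 2 ∨
      QSD.numExtremePoints q ρ = 3 := by
    have := QSD.ncard_extremePoints_mem u
    omega
  have he₁0 : 0 ≤ e₁ := by linarith [hq_order.1]
  have he₂0 : 0 ≤ e₂ := by linarith [hq_order.1, hq_order.2]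
  have hone : QSD.numExtremePoints q ρ = 1 → IsGreatest (QSD.correctProbs q ρ) (q 0) := by
    intro h
    -- The balls are concentric, and the largest has radius `q 0`.
    have heq := QSD.eq_of_ncard_extremePoints_eq_one u (hcount ▸ h)
    refine QSD.isGreatest_correctProbs hρ (QSD.exists_correctProb_eq_prior hρ 0) (c := u 0)
      fun i => ?_
    rw [← hu, heq 0 i, sub_self, norm_zero]
    fin_cases i <;> simp <;> linarith
  have hpair : QSD.numExtremePoints q ρ = 2 ∨
        (QSD.numExtremePoints q ρ = 3 ∧ ¬ QSD.TriangleConditions l₁ l₂ e₁ e₂ θ₁ θ₂ χ) →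
      IsGreatest (QSD.correctProbs q ρ) (QSD.guessProb q ρ) ∧
        IsGreatest (QSD.helstromValues q ρ) (QSD.guessProb q ρ) := by
    intro h
    refine QSD.isGreatest_of_pair_cover hρ ?_
    rw [← hu]
    rcases h with h | ⟨h, hnot⟩
    · obtain ⟨p, n, t, hn, ht⟩ := QSD.exists_line_of_ncard_extremePoints_eq_two u (hcount ▸ h)
      exact QSD.exists_pair_cover_of_line hn ht
    · obtain ⟨hl₁0, hl₂0, hθ0, hθπ, hin⟩ := QSD.triangle_nondegenerate hl₁ hl₂ hθ₁
        (QSD.not_collinear_of_ncard_extremePoints_eq_three u (hcount ▸ h))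
      exact QSD.exists_pair_cover_of_not_triangleConditions hl₁0 hl₂0 he₁0 he₂0 he₁ he₂ hθ0 hθπ
        hl₁.symm hl₂.symm hin hθ₂ hχ hnot
  have htri : QSD.numExtremePoints q ρ = 3 ∧ QSD.TriangleConditions l₁ l₂ e₁ e₂ θ₁ θ₂ χ →
      IsGreatest (QSD.correctProbs q ρ) (q 0 + r₁) ∧
      QSD.IsOptimalPOVM q ρ (fun i =>
        (QSD.optWeight l₁ l₂ e₁ e₂ θ₁ χ r₁ i : ℂ) •
          (1 - QSD.pauliDot (QSD.optDir u l₁ l₂ e₁ e₂ θ₁ χ r₁ i))) := by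
    rintro ⟨h, ⟨h₁, h₂⟩, ⟨hb₁, hb₂⟩, hc⟩
    obtain ⟨hl₁0, hl₂0, hθ0, hθπ, hin⟩ := QSD.triangle_nondegenerate hl₁ hl₂ hθ₁
      (QSD.not_collinear_of_ncard_extremePoints_eq_three u (hcount ▸ h))
    obtain ⟨hχ0, hχθ, hr, hw, hw₁, hw₂⟩ := QSD.touching_center hl₁0 hl₂0 he₁0 he₂0 hθ0 hθπ
      hl₁.symm hl₂.symm hin h₁ h₂ hb₁ hb₂ hχ hr₁
    refine QSD.optimal_of_inside hρ hu hl₁0 hl₂0 he₁0 he₂0 he₁ he₂ hθ0 hθπ hχ0 hχθ hr hw hw₁ hw₂ ?_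
    rw [← hr₁, QSD.opposite_side_distance hl₁0 hl₂0 hθ0 hθπ hl₁.symm hl₂.symm hin hθ₂,
      lt_div_iff₀] at hc
    · exact hc.le
    · exact add_pos (mul_pos hl₁0 (Real.sin_pos_of_pos_of_lt_pi hχ0 (by linarith)))
        (mul_pos hl₂0 (Real.sin_pos_of_pos_of_lt_pi (by linarith) (by linarith)))
  refine ⟨?_, hex, fun h => QSD.guessProb_eq (hone h), fun h => (hpair h).2, fun h => ?_⟩
  · rcases hex with h | h | h
    · rw [QSD.guessProb_eq (hone h)]
      exact hone h
    · exact (hpair (.inl h)).1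
    · by_cases ht : QSD.TriangleConditions l₁ l₂ e₁ e₂ θ₁ θ₂ χ
      · rw [QSD.guessProb_eq (htri ⟨h, ht⟩).1]
        exact (htri ⟨h, ht⟩).1
      · exact (hpair (.inr ⟨h, ht⟩)).1
  · rw [← hr₁]
    exact ⟨QSD.guessProb_eq (htri h).1, (htri h).2⟩
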